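/- Let $d\ge 0$ and let $p_0,p_1$ be probability measures on $\mathbb{R}^d$ with finite second moments. Let $x_0\sim p_0$ and $x_1\sim p_1$ be random vectors on a common probability space (for instance independent; no assumption on their joint law is needed), and for $s\in[0,1]$ let $p_s$ denote the law of $x_s:=(1-s)x_0+s x_1$. For a Borel measurable velocity field $v:\mathbb{R}^d\times\mathbb{R}\times\mathbb{R}\to\mathbb{R}^d$, $(x,\tau,\alpha)\mapsto v(x,\tau,\alpha)$, a depth $D\ge 2$ and a weight $\lambda\ge 0$, the RecFM training loss is $$\mathcal L_{\rm total}(v)=\mathbb{E}\Big[\sum_{i=1}^{D}\big\|v\big(x_t,\tfrac{t}{\alpha^{i-1}},\alpha^{i-1}\big)-\alpha^{i-1}(x_1-x_0)\big\|^2+\lambda\sum_{i=2}^{D}\big\|v\big(x_t,\tfrac{t}{\alpha^{i-1}},\alpha^{i-1}\big)-\alpha^{i-1}v(x_t,t,1)\big\|^2\Big],$$ where $t\sim\mathcal U(0,1)$, $\alpha\sim\mathcal U(t,1)$ given $t$, and $(t,\alpha)$ is independent of $(x_0,x_1)$. Let $(v_\theta)_{\theta\in\Theta}$ be a class of measurable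 velocity fields that is sufficiently expressive, in the sense that $\inf_{\theta}\mathcal L_{\rm total}(v_\theta)$ equals the infimum of $\mathcal L_{\rm total}$ over all measurable velocity fields, and let $\theta^*$ be a global minimizer of $\theta\mapsto\mathcal L_{\rm total}(v_\theta)$. Assume that $v_{\theta^*}$ is continuous on $\mathbb{R}^d\times[0,1]\times(0,1]$ and that $v_{\theta^*}(\cdot,t,\alpha)$ is Lipschitz in $x$ uniformly over $t\in[0,1]$ and $\alpha\in(0,1]$. **Theorem (Marginal Preservation of the Secondary Trajectory).** Fix $\alpha\in(0,1]$ and consider the ODE $$\frac{dx}{d\tau}=v_{\theta^*}(x,\tau,\alpha),\quad \tau\in[0,1],\qquad x(0)\sim p_0 .$$ For every initial point the ODE has exactly one solution on $[0,1]$. If $q^{(\alpha)}_\tau$ denotes the law of $x(\tau)$ for a solution with random initial value $x(0)\sim p_0$, then for every $\tau\in[0,1]$ the measure $q^{(\alpha)}_\tau$ is the law of $(1-\alpha\tau)x_0+\alpha\tau x_1$. In particular $q^{(\alpha)}_0=p_0$ and $q^{(\alpha)}_1=p_\alpha$. -/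

import Mathlib

open MeasureTheory ProbabilityTheory Set
open scoped ENNReal NNReal

namespace RecFM

/-- The state space `ℝ^d` with its Euclidean norm. -/
abbrev State (d : ℕ) : Type := EuclideanSpace ℝ (Fin d)

/-- A scale-conditioned velocity field `v(x, τ, α)`. -/
abbrev VelocityField (d : ℕ) : Type := State d → ℝ → ℝ → State d

/-- Joint measurability of a velocity field in `(x, τ, α)`. -/
def IsMeasurableField {d : ℕ} (v : VelocityField d) : Prop :=
  Measurable fun z : State d × ℝ × ℝ => v z.1 z.2.1 z.2.2

/-- The linear interpolant `(1 - s) x₀ + s x₁`. -/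
def interpolant {d : ℕ} {Ω : Type*} (x₀ x₁ : Ω → State d) (s : ℝ) (ω : Ω) : State d :=
  (1 - s) • x₀ ω + s • x₁ ω

/-- The marginal `p_s`: the law of `(1 - s) x₀ + s x₁`. -/
noncomputable def marginal {d : ℕ} {Ω : Type*} [MeasurableSpace Ω] (P : Measure Ω)
    (x₀ x₁ : Ω → State d) (s : ℝ) : Measure (State d) :=
  P.map (interpolant x₀ x₁ s)

/-- Trajectory supervision for the sample `(y₀, y₁)`, primary time `t` and scale `a`:
`‖v(x_t, t / a, a) - a (y₁ - y₀)‖²` with `x_t = (1 - t) y₀ + t y₁`. -/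
noncomputable def trajLoss {d : ℕ} (v : VelocityField d) (t a : ℝ) (y₀ y₁ : State d) : ℝ≥0∞ :=
  ‖v ((1 - t) • y₀ + t • y₁) (t / a) a - a • (y₁ - y₀)‖ₑ ^ 2

/-- Cross-scale consistency for the sample `(y₀, y₁)`, primary time `t` and scale `a`:
`‖v(x_t, t / a, a) - a v(x_t, t, 1)‖²` with `x_t = (1 - t) y₀ + t y₁`. -/
noncomputable def consLoss {d : ℕ} (v : VelocityField d) (t a : ℝ) (y₀ y₁ : State d) : ℝ≥0∞ :=
  ‖v ((1 - t) • y₀ + t • y₁) (t / a) a - a • v ((1 - t) • y₀ + t • y₁) t 1‖ₑ ^ 2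

/-- The per-sample loss at depth `D`. The scales are `1, α, …, α ^ (D - 1)`; the index `i` below
counts from `0`, so `i = 0` is the primary trajectory. -/
noncomputable def sampleLoss {d : ℕ} (D : ℕ) (lam : ℝ≥0) (v : VelocityField d) (t α : ℝ)
    (y₀ y₁ : State d) : ℝ≥0∞ :=
  ∑ i ∈ Finset.range D, trajLoss v t (α ^ i) y₀ y₁
    + lam * ∑ i ∈ Finset.Ico 1 D, consLoss v t (α ^ i) y₀ y₁

/-- The total training loss: the expectation of the per-sample loss over `t ∼ U(0,1)`,
`α ∼ U(t,1)` given `t`, and the pair `(x₀, x₁)`, drawn independently of `(t, α)`. -/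
noncomputable def totalLoss {d : ℕ} {Ω : Type*} [MeasurableSpace Ω] (P : Measure Ω)
    (x₀ x₁ : Ω → State d) (D : ℕ) (lam : ℝ≥0) (v : VelocityField d) : ℝ≥0∞ :=
  ∫⁻ t in Icc (0 : ℝ) 1, ∫⁻ α, ∫⁻ ω, sampleLoss D lam v t α (x₀ ω) (x₁ ω) ∂P
    ∂(ProbabilityTheory.cond volume (Icc t 1))

/-- A parametric class of (measurable) velocity fields is sufficiently expressive for the total
loss if its infimal loss is the infimal loss over all measurable velocity fields. -/
def SufficientlyExpressive {d : ℕ} {Ω : Type*} [MeasurableSpace Ω] (P : Measure Ω)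
    (x₀ x₁ : Ω → State d) (D : ℕ) (lam : ℝ≥0) {Θ : Type*} (v : Θ → VelocityField d) : Prop :=
  (∀ θ, IsMeasurableField (v θ)) ∧
    ∀ w : VelocityField d, IsMeasurableField w →
      ⨅ θ, totalLoss P x₀ x₁ D lam (v θ) ≤ totalLoss P x₀ x₁ D lam w

/-- `θ` is a global minimizer of the total loss over the parametric class `v`. -/
def IsGlobalMinimizer {d : ℕ} {Ω : Type*} [MeasurableSpace Ω] (P : Measure Ω)
    (x₀ x₁ : Ω → State d) (D : ℕ) (lam : ℝ≥0) {Θ : Type*} (v : Θ → VelocityField d)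
    (θ : Θ) : Prop :=
  ∀ θ', totalLoss P x₀ x₁ D lam (v θ) ≤ totalLoss P x₀ x₁ D lam (v θ')

/-- `y` solves `dy/dτ = v(y, τ, α)` on `[0, 1]` (one-sided derivatives at the endpoints). -/
def IsTrajectory {d : ℕ} (v : VelocityField d) (α : ℝ) (y : ℝ → State d) : Prop :=
  ∀ τ ∈ Icc (0 : ℝ) 1, HasDerivWithinAt y (v (y τ) τ α) (Icc 0 1) τ

/-- The random curve `X` is a solution of `dx/dτ = v(x, τ, α)`, `x(0) ∼ p₀`, on `[0, 1]`. -/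
structure IsRandomTrajectory {d : ℕ} (v : VelocityField d) (α : ℝ) (p₀ : Measure (State d))
    {Ω' : Type*} [MeasurableSpace Ω'] (P' : Measure Ω') (X : ℝ → Ω' → State d) : Prop where
  initial : HasLaw (X 0) p₀ P'
  ode : ∀ᵐ ω ∂P', IsTrajectory v α fun τ => X τ ω

end RecFM

/-! Write `u t x` for the conditional mean of `x₁ - x₀` given `x_t = x`. For fixed `t` and scale
`a`, trajectory supervision is a least-squares regression of `a (x₁ - x₀)` on `x_t`, so its
expectation is an irreducible variance plus the squared distance from the field to `a u t`. The
field `scaledField u`, with value `a u(aτ, x)`, makes every such excess vanish and every consistency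
term as well. Expressiveness therefore puts the loss of the minimizer `v` below that of `scaledField
u`. The irreducible part is finite, so it cancels, and the excess of `v` at scale `α` is zero:
`v(x_t, t/α, α) = α u(t, x_t)` almost surely, for almost all `t` and `α`
(`ae_eq_conditional_velocity`).

Since `u` is only measurable, this identity cannot be extended by continuity as it stands. Its weak
form, `E[G(x_t)(v(x_t, t/α, α) - α (x₁ - x₀))] = 0`, no longer contains `u` and is continuous in
time and scale; it thus holds for every `α` in `(0,1]` and every `t` in `[0, α]`
(`integral_residual_eq_zero`). With `t = ατ` it says that the laws of `x₀ + τ α (x₁ - x₀)` solve the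
continuity equation of the Lipschitz field `v(·, τ, α)`.

What remains is uniqueness for that equation (`hasLaw_of_conditional_velocity`), proved by discrete
duality. The field is mollified, and a character is composed with the remaining Euler steps, which
plays the role of a backward transport solution. Exchanging straight motion for one Euler step costs
`O(δε + δ²)`, and the total vanishes when the grid is refined fast enough relative to the
mollification. The same schemes started from `X 0` converge to `X T` along trajectories, so the two
characteristic functions agree. -/

namespace RecFM

/-! ### Functions with bounded Lipschitz derivative, and mollification -/

/-- `f'` is the derivative of `f`, is bounded by `L` and is Lipschitz with constant `H`. -/
structure HasBoundedC11 {E F : Type*} [NormedAddCommGroup E] [NormedSpace ℝ E]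
    [NormedAddCommGroup F] [NormedSpace ℝ F] (f : E → F) (f' : E → E →L[ℝ] F) (L H : ℝ) :
    Prop where
  hasFDerivAt : ∀ x, HasFDerivAt f (f' x) x
  norm_le : ∀ x, ‖f' x‖ ≤ L
  lipschitz : ∀ x y, ‖f' x - f' y‖ ≤ H * ‖x - y‖

namespace HasBoundedC11

variable {E F : Type*} [NormedAddCommGroup E] [NormedSpace ℝ E]
  [NormedAddCommGroup F] [NormedSpace ℝ F] {f : E → F} {f' : E → E →L[ℝ] F} {L H : ℝ}

lemma continuous (h : HasBoundedC11 f f' L H) : Continuous f :=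
  continuous_iff_continuousAt.2 fun x => (h.hasFDerivAt x).continuousAt

lemma continuous_deriv (h : HasBoundedC11 f f' L H) : Continuous f' := by
  refine (LipschitzWith.of_dist_le_mul (K := H.toNNReal) fun x y => ?_).continuous
  rw [dist_eq_norm, dist_eq_norm]
  exact (h.lipschitz x y).trans
    (mul_le_mul_of_nonneg_right (Real.le_coe_toNNReal H) (norm_nonneg _))

lemma nonneg (h : HasBoundedC11 f f' L H) : 0 ≤ L := (norm_nonneg _).trans (h.norm_le 0)

lemma norm_sub_le (h : HasBoundedC11 f f' L H) (x y : E) : ‖f x - f y‖ ≤ L * ‖x - y‖ :=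
  Convex.norm_image_sub_le_of_norm_hasFDerivWithin_le (s := univ)
    (fun z _ => (h.hasFDerivAt z).hasFDerivWithinAt) (fun z _ => h.norm_le z) convex_univ
    (mem_univ y) (mem_univ x)

/-- Mean value inequality on the segment for `f - f' x`, whose derivative there is at most `H *
‖a‖`. The sharp factor 1/2 is not needed. -/
lemma norm_taylor_le (h : HasBoundedC11 f f' L H) (hH : 0 ≤ H) (x a : E) :
    ‖f (x + a) - f x - f' x a‖ ≤ H * ‖a‖ ^ 2 := by
  have key := Convex.norm_image_sub_le_of_norm_hasFDerivWithin_le' (f := f) (φ := f' x)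
    (s := segment ℝ x (x + a)) (C := H * ‖a‖) (x := x) (y := x + a)
    (fun z _ => (h.hasFDerivAt z).hasFDerivWithinAt) (fun z hz => ?_) (convex_segment _ _)
    (left_mem_segment _ _ _) (right_mem_segment _ _ _)
  · rw [add_sub_cancel_left] at key
    exact key.trans_eq (by ring)
  · refine (h.lipschitz z x).trans (mul_le_mul_of_nonneg_left ?_ hH)
    rw [segment_eq_image'] at hz
    obtain ⟨t, ht, rfl⟩ := hz
    simp only [add_sub_cancel_left, norm_smul, Real.norm_eq_abs, abs_of_nonneg ht.1]
    exact mul_le_of_le_one_left (norm_nonneg _) ht.2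

/-- Composition with one explicit Euler step. -/
lemma comp_eulerStep (h : HasBoundedC11 f f' L H) (hH : 0 ≤ H) {B : E → E} {B' : E → E →L[ℝ] E}
    {K M : ℝ} (hB : HasBoundedC11 B B' K M) {δ : ℝ} (hδ : 0 ≤ δ) :
    HasBoundedC11 (fun x => f (x + δ • B x))
      (fun x => (f' (x + δ • B x)).comp (ContinuousLinearMap.id ℝ E + δ • B' x))
      (L * (1 + δ * K)) (H * (1 + δ * K) ^ 2 + L * (δ * M)) := by
  have hL := h.nonneg
  have hK := hB.nonneg
  have hS : ∀ x, ‖ContinuousLinearMap.id ℝ E + δ • B' x‖ ≤ 1 + δ * K := fun x => by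
    refine (norm_add_le _ _).trans (add_le_add ContinuousLinearMap.norm_id_le ?_)
    rw [norm_smul, Real.norm_eq_abs, abs_of_nonneg hδ]
    exact mul_le_mul_of_nonneg_left (hB.norm_le x) hδ
  have hlip : ∀ x y, ‖(x + δ • B x) - (y + δ • B y)‖ ≤ (1 + δ * K) * ‖x - y‖ := fun x y => by
    have : (x + δ • B x) - (y + δ • B y) = (x - y) + δ • (B x - B y) := by
      rw [smul_sub]; abel
    rw [this]
    refine (norm_add_le _ _).trans ?_
    rw [norm_smul, Real.norm_eq_abs, abs_of_nonneg hδ]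
    nlinarith [mul_le_mul_of_nonneg_left (hB.norm_sub_le x y) hδ]
  refine ⟨fun x => ?_, fun x => ?_, fun x y => ?_⟩
  · exact (h.hasFDerivAt _).comp x ((hasFDerivAt_id x).add ((hB.hasFDerivAt x).const_smul δ))
  · refine (ContinuousLinearMap.opNorm_comp_le _ _).trans ?_
    gcongr
    · exact h.norm_le _
    · exact hS x
  -- The outer derivative is varied first, then the inner one. In the first term one factor `1 + δ *
  -- K` comes from the Lipschitz constant of the step and the other from its derivative.
  · have : (f' (x + δ • B x)).comp (ContinuousLinearMap.id ℝ E + δ • B' x) -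
        (f' (y + δ • B y)).comp (ContinuousLinearMap.id ℝ E + δ • B' y) =
        (f' (x + δ • B x) - f' (y + δ • B y)).comp (ContinuousLinearMap.id ℝ E + δ • B' x) +
        (f' (y + δ • B y)).comp (δ • (B' x - B' y)) := by
      ext z
      simp [smul_sub]
      abel
    rw [this]
    refine (norm_add_le _ _).trans ?_
    have e1 : ‖(f' (x + δ • B x) - f' (y + δ • B y)).comp
        (ContinuousLinearMap.id ℝ E + δ • B' x)‖ ≤
        (H * ((1 + δ * K) * ‖x - y‖)) * (1 + δ * K) := by
      refine (ContinuousLinearMap.opNorm_comp_le _ _).trans ?_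
      gcongr
      · exact (h.lipschitz _ _).trans (mul_le_mul_of_nonneg_left (hlip x y) hH)
      · exact hS x
    have e2 : ‖(f' (y + δ • B y)).comp (δ • (B' x - B' y))‖ ≤ L * (δ * (M * ‖x - y‖)) := by
      refine (ContinuousLinearMap.opNorm_comp_le _ _).trans ?_
      rw [norm_smul, Real.norm_eq_abs, abs_of_nonneg hδ]
      gcongr
      · exact h.norm_le _
      · exact hB.lipschitz x y
    nlinarith [e1, e2]

end HasBoundedC11

/-- Lipschitz fields are uniformly approximated by `C^{1,1}` fields with the same Lipschitz
constant; the second order bound depends only on the accuracy and on the Lipschitz constant. -/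
lemma exists_hasBoundedC11_approx {d : ℕ} (K : ℝ≥0) {ε : ℝ} (hε : 0 < ε) :
    ∃ M : ℝ, 0 ≤ M ∧ ∀ f : State d → State d, LipschitzWith K f →
      ∃ B B', HasBoundedC11 B B' K M ∧ ∀ x, ‖B x - f x‖ ≤ ε := by
  -- Dividing by `K + 1` rather than `K` keeps the radius finite and positive when `K = 0`.
  set r : ℝ := ε / (K + 1) with hr
  have hK1 : (0 : ℝ) < K + 1 := by positivity
  have hr0 : 0 < r := by positivity
  let φ : ContDiffBump (0 : State d) := ⟨r / 2, r, by positivity, by linarith⟩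
  set ρ : State d → ℝ := φ.normed volume with hρ
  have hρc : ContDiff ℝ 1 ρ := φ.contDiff_normed
  have hρs : HasCompactSupport ρ := φ.hasCompactSupport_normed
  let Lm : ℝ →L[ℝ] State d →L[ℝ] State d := ContinuousLinearMap.lsmul ℝ ℝ
  have hcont' : Continuous (fderiv ℝ ρ) := hρc.continuous_fderiv one_ne_zero
  have hsupp' : HasCompactSupport (fderiv ℝ ρ) := hρs.fderiv ℝ
  have hint' : Integrable (fun y => ‖fderiv ℝ ρ y‖) volume :=
    (hcont'.integrable_of_hasCompactSupport hsupp').norm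
  -- The derivative falls on the kernel and the increment on `f`, so `f` enters only through `K`.
  -- One constant can then serve a whole family of `K`-Lipschitz fields.
  refine ⟨‖Lm.precompL (State d)‖ * (∫ y, ‖fderiv ℝ ρ y‖) * K, by positivity, fun f hf => ?_⟩
  have hfl : LocallyIntegrable f volume := hf.continuous.locallyIntegrable
  set B : State d → State d := convolution ρ f Lm volume with hB
  set B' := convolution (fderiv ℝ ρ) f (Lm.precompL (State d)) volume with hB'
  have hder : ∀ x, HasFDerivAt B (B' x) x := fun x =>
    hρs.hasFDerivAt_convolution_left Lm hρc hfl x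
  have hex : ∀ x, ConvolutionExistsAt ρ f x Lm volume := fun x =>
    hρs.convolutionExists_left Lm hρc.continuous hfl x
  have hex' : ∀ x, ConvolutionExistsAt (fderiv ℝ ρ) f x (Lm.precompL (State d)) volume := fun x =>
    hsupp'.convolutionExists_left _ hcont' hfl x
  have hlip : LipschitzWith K B := by
    refine LipschitzWith.of_dist_le_mul fun x y => ?_
    rw [dist_eq_norm, dist_eq_norm, hB, convolution, convolution,
      ← integral_sub (hex x).integrable (hex y).integrable]
    refine (norm_integral_le_of_norm_le (g := fun z => ρ z * (K * ‖x - y‖)) ?_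
      (Filter.Eventually.of_forall fun z => ?_)).trans ?_
    · exact (hρc.continuous.integrable_of_hasCompactSupport hρs).mul_const _
    · have : ‖Lm (ρ z) (f (x - z)) - Lm (ρ z) (f (y - z))‖ = ρ z * ‖f (x - z) - f (y - z)‖ := by
        rw [← map_sub]
        simp only [Lm, ContinuousLinearMap.lsmul_apply, norm_smul, Real.norm_eq_abs]
        rw [abs_of_nonneg (φ.nonneg_normed z)]
      simp only [this]
      refine mul_le_mul_of_nonneg_left ?_ (φ.nonneg_normed z)
      simpa using hf.norm_sub_le (x - z) (y - z)
    · rw [integral_mul_const, φ.integral_normed, one_mul]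
  refine ⟨B, B', ⟨hder, fun x => ?_, fun x y => ?_⟩, fun x => ?_⟩
  · exact (hder x).le_of_lipschitz hlip
  · rw [hB', convolution, convolution, ← integral_sub (hex' x).integrable (hex' y).integrable]
    refine (norm_integral_le_of_norm_le
      (g := fun z => ‖Lm.precompL (State d)‖ * ‖fderiv ℝ ρ z‖ * (K * ‖x - y‖)) ?_
      (Filter.Eventually.of_forall fun z => ?_)).trans ?_
    · exact (hint'.const_mul _).mul_const _
    · rw [← map_sub]
      refine (ContinuousLinearMap.le_opNorm₂ _ _ _).trans ?_
      refine mul_le_mul_of_nonneg_left ?_ (by positivity)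
      simpa using hf.norm_sub_le (x - z) (y - z)
    · rw [integral_mul_const, integral_const_mul, mul_assoc _ (K : ℝ)]
  · rw [← dist_eq_norm]
    refine φ.dist_normed_convolution_le hf.continuous.aestronglyMeasurable fun y hy => ?_
    refine (hf.dist_le_mul y x).trans ?_
    have hy' : dist y x ≤ r := (Metric.mem_ball.1 hy).le
    calc (K : ℝ) * dist y x ≤ (K + 1) * r :=
          mul_le_mul (by linarith) hy' dist_nonneg hK1.le
      _ = ε := by rw [hr]; field_simp

/-! ### Euler schemes: regularity and convergence -/

/-- `j` explicit Euler steps of size `δ` for the field `B`, started at time `s`. -/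
def eulerIter {E : Type*} [NormedAddCommGroup E] [NormedSpace ℝ E] (B : ℝ → E → E) (δ : ℝ) :
    ℕ → ℝ → E → E
  | 0, _, x => x
  | j + 1, s, x => eulerIter B δ j (s + δ) (x + δ • B s x)

section Euler

variable {E F : Type*} [NormedAddCommGroup E] [NormedSpace ℝ E]
  [NormedAddCommGroup F] [NormedSpace ℝ F]

lemma HasBoundedC11.mono {f : E → F} {f' : E → E →L[ℝ] F} {L H L' H' : ℝ}
    (h : HasBoundedC11 f f' L H) (hL : L ≤ L') (hH : H ≤ H') : HasBoundedC11 f f' L' H' :=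
  ⟨h.hasFDerivAt, fun x => (h.norm_le x).trans hL, fun x y =>
    (h.lipschitz x y).trans (mul_le_mul_of_nonneg_right hH (norm_nonneg _))⟩

/-- Composing a `C^{1,1}` function with an Euler scheme costs constants independent of the
step size. -/
lemma HasBoundedC11.comp_eulerIter {f : E → F} {f' : E → E →L[ℝ] F} {L H : ℝ}
    (h : HasBoundedC11 f f' L H) (hH : 0 ≤ H) {B : ℝ → E → E} {K M δ : ℝ} (hK : 0 ≤ K)
    (hM : 0 ≤ M) (hδ : 0 ≤ δ)
    (hB : ∀ s ∈ Icc (0 : ℝ) 1, ∃ B', HasBoundedC11 (B s) B' K M) (j : ℕ) (s : ℝ) (hs : 0 ≤ s)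
    (hj : s + j * δ ≤ 1) :
    ∃ g, HasBoundedC11 (fun x => f (eulerIter B δ j s x)) g (L * Real.exp (j * δ * K))
      (Real.exp (2 * (j * δ * K)) * (H + j * δ * (M * (L * Real.exp K)))) := by
  have hL := h.nonneg
  induction j generalizing s with
  | zero => exact ⟨f', by simpa [eulerIter] using h⟩
  | succ j ih =>
    push_cast at hj ⊢
    have hjδ : 0 ≤ j * δ := by positivity
    obtain ⟨g, hg⟩ := ih (s + δ) (by linarith) (by linarith)
    obtain ⟨B', hB'⟩ := hB s ⟨hs, by nlinarith⟩
    have e1 : 1 + δ * K ≤ Real.exp (δ * K) := by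
      linarith [Real.add_one_le_exp (δ * K)]
    -- Freezing this exponential at `Real.exp K`, possible since `j * δ ≤ 1`, makes the contribution
    -- of `M` linear in `j`.
    have e2 : Real.exp (j * δ * K) ≤ Real.exp K := Real.exp_le_exp.2 (by nlinarith)
    have h0 : 0 ≤ 1 + δ * K := by positivity
    -- `eulerIter` peels off the earliest step, so the inductive hypothesis at time `s + δ` is
    -- precomposed with a single step.
    refine ⟨_, (hg.comp_eulerStep (by positivity) hB' hδ).mono ?_ ?_⟩
    · calc L * Real.exp (j * δ * K) * (1 + δ * K)
          ≤ L * Real.exp (j * δ * K) * Real.exp (δ * K) := by gcongr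
        _ = L * Real.exp ((j + 1) * δ * K) := by
          rw [mul_assoc, ← Real.exp_add]; ring_nf
    · have e3 : Real.exp (2 * (j * δ * K)) * (1 + δ * K) ^ 2 ≤
          Real.exp (2 * ((j + 1) * δ * K)) := by
        calc Real.exp (2 * (j * δ * K)) * (1 + δ * K) ^ 2
            ≤ Real.exp (2 * (j * δ * K)) * Real.exp (δ * K) ^ 2 := by gcongr
          _ = Real.exp (2 * ((j + 1) * δ * K)) := by
            rw [← Real.exp_nat_mul, ← Real.exp_add]; push_cast; ring_nf
      have e4 : 1 ≤ Real.exp (2 * ((j + 1) * δ * K)) := Real.one_le_exp (by positivity)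
      have e5 : 0 ≤ δ * (M * (L * Real.exp K)) := by positivity
      calc Real.exp (2 * (j * δ * K)) * (H + j * δ * (M * (L * Real.exp K))) * (1 + δ * K) ^ 2 +
            L * Real.exp (j * δ * K) * (δ * M)
          ≤ Real.exp (2 * (j * δ * K)) * (1 + δ * K) ^ 2 *
              (H + j * δ * (M * (L * Real.exp K))) + δ * (M * (L * Real.exp K)) := by
            refine add_le_add (le_of_eq (by ring)) ?_
            calc L * Real.exp (j * δ * K) * (δ * M) ≤ L * Real.exp K * (δ * M) := by gcongr
              _ = _ := by ring
        _ ≤ Real.exp (2 * ((j + 1) * δ * K)) * (H + j * δ * (M * (L * Real.exp K))) +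
              Real.exp (2 * ((j + 1) * δ * K)) * (δ * (M * (L * Real.exp K))) := by
            refine add_le_add (by gcongr) (le_mul_of_one_le_left e5 e4)
        _ = _ := by ring

/-- The Euler scheme stays close to an exact trajectory. -/
lemma norm_sub_eulerIter_le {b B : ℝ → E → E} {y : ℝ → E} {K ε η δ : ℝ} (hK : 0 ≤ K)
    (hε : 0 ≤ ε) (hη : 0 ≤ η) (hδ : 0 ≤ δ)
    (hB : ∀ s ∈ Icc (0 : ℝ) 1, ∀ x x', ‖B s x - B s x'‖ ≤ K * ‖x - x'‖)
    (hBb : ∀ s ∈ Icc (0 : ℝ) 1, ∀ x, ‖B s x - b s x‖ ≤ ε)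
    (hy : ∀ s ∈ Icc (0 : ℝ) 1, HasDerivWithinAt y (b s (y s)) (Icc 0 1) s)
    (hosc : ∀ s ∈ Icc (0 : ℝ) 1, ∀ t ∈ Icc (0 : ℝ) 1, |t - s| ≤ δ →
      ‖b t (y t) - b s (y s)‖ ≤ η) (j : ℕ) (s : ℝ) (hs : 0 ≤ s) (hj : s + j * δ ≤ 1) (x : E) :
    ‖y (s + j * δ) - eulerIter B δ j s x‖ ≤
      Real.exp (j * δ * K) * (‖y s - x‖ + j * δ * (ε + η)) := by
  induction j generalizing s x with
  | zero => simp [eulerIter]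
  | succ j ih =>
    push_cast at hj ⊢
    have hjδ : 0 ≤ j * δ := by positivity
    have hs1 : s ∈ Icc (0 : ℝ) 1 := ⟨hs, by nlinarith⟩
    have hs2 : s + δ ∈ Icc (0 : ℝ) 1 := ⟨by linarith, by nlinarith⟩
    have hsub : Icc s (s + δ) ⊆ Icc 0 1 := Icc_subset_Icc hs hs2.2
    -- Local truncation error: `t ↦ y t - t • b s (y s)` has derivative at most `η` on the step.
    have rem : ‖y (s + δ) - y s - δ • b s (y s)‖ ≤ η * δ := by
      have := Convex.norm_image_sub_le_of_norm_hasDerivWithin_le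
        (f := fun t => y t - t • b s (y s)) (f' := fun t => b t (y t) - b s (y s))
        (s := Icc s (s + δ)) (C := η) (x := s) (y := s + δ)
        (fun t ht => ((hy t (hsub ht)).mono hsub).sub
          (by simpa using (hasDerivWithinAt_id t (Icc s (s + δ))).smul_const (b s (y s))))
        (fun t ht => hosc s hs1 t (hsub ht) (by
          rw [abs_of_nonneg (by linarith [ht.1])]; linarith [ht.2])) (convex_Icc _ _)
        ⟨le_rfl, by linarith⟩ ⟨by linarith, le_rfl⟩
      rw [add_sub_cancel_left, Real.norm_eq_abs, abs_of_nonneg hδ] at this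
      refine le_of_eq_of_le (congrArg _ ?_) this
      rw [add_smul]; abel
    have step : ‖y (s + δ) - (x + δ • B s x)‖ ≤ (1 + δ * K) * ‖y s - x‖ + δ * (ε + η) := by
      have : y (s + δ) - (x + δ • B s x) = (y (s + δ) - y s - δ • b s (y s)) + (y s - x)
          + δ • ((B s (y s) - B s x) - (B s (y s) - b s (y s))) := by
        simp only [smul_sub]; abel
      rw [this]
      have h1 := hB s hs1 (y s) x
      have h2 := hBb s hs1 (y s)
      refine (norm_add_le _ _).trans ?_
      refine (add_le_add (norm_add_le _ _) le_rfl).trans ?_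
      rw [norm_smul, Real.norm_eq_abs, abs_of_nonneg hδ]
      have h3 : ‖(B s (y s) - B s x) - (B s (y s) - b s (y s))‖ ≤ K * ‖y s - x‖ + ε :=
        (norm_sub_le _ _).trans (add_le_add h1 h2)
      nlinarith [mul_le_mul_of_nonneg_left h3 hδ]
    have key := ih (s + δ) hs2.1 (by linarith) (x + δ • B s x)
    rw [show s + (j + 1) * δ = s + δ + j * δ by ring]
    refine key.trans ?_
    have e1 : 1 + δ * K ≤ Real.exp (δ * K) := by
      linarith [Real.add_one_le_exp (δ * K)]
    have e2 : 1 ≤ Real.exp (δ * K) := Real.one_le_exp (by positivity)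
    have e3 : Real.exp ((j + 1) * δ * K) = Real.exp (j * δ * K) * Real.exp (δ * K) := by
      rw [← Real.exp_add]; ring_nf
    rw [e3, mul_assoc (Real.exp _)]
    refine mul_le_mul_of_nonneg_left ?_ (Real.exp_pos _).le
    have e4 : 0 ≤ (j + 1) * δ * (ε + η) := by positivity
    calc ‖y (s + δ) - (x + δ • B s x)‖ + j * δ * (ε + η)
        ≤ (1 + δ * K) * ‖y s - x‖ + (j + 1) * δ * (ε + η) := by linarith
      _ ≤ Real.exp (δ * K) * ‖y s - x‖ + Real.exp (δ * K) * ((j + 1) * δ * (ε + η)) :=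
          add_le_add (by gcongr) (le_mul_of_one_le_left e4 e2)
      _ = _ := by ring

end Euler

/-! ### Uniqueness for the continuity equation -/

/-- The characters are `C^{1,1}`. -/
lemma hasBoundedC11_character {d : ℕ} (ξ : State d) :
    ∃ f', HasBoundedC11 (fun x : State d => Complex.exp (inner ℝ x ξ * Complex.I)) f'
      ‖ξ‖ (‖ξ‖ * ‖ξ‖) := by
  set f : State d → ℂ := fun x => Complex.exp (inner ℝ x ξ * Complex.I) with hf
  let f' : State d → State d →L[ℝ] ℂ := fun x =>
    (innerSL ℝ ξ).smulRight (f x * Complex.I)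
  have hder : ∀ x, HasFDerivAt f (f' x) x := fun x => by
    have h1 : HasFDerivAt (fun x : State d => (inner ℝ x ξ : ℝ)) (innerSL ℝ ξ) x := by
      simpa [real_inner_comm] using (innerSL ℝ ξ).hasFDerivAt (x := x)
    have h2 := (Complex.ofRealCLM.hasFDerivAt.comp x h1).mul_const Complex.I
    have h3 := h2.cexp
    refine h3.congr_fderiv ?_
    ext z
    simp [f', hf]
    ring
  have hnorm : ∀ x, ‖f x‖ = 1 := fun x => Complex.norm_exp_ofReal_mul_I _
  have hb : ∀ x, ‖f' x‖ ≤ ‖ξ‖ := fun x => by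
    simp [f', ContinuousLinearMap.norm_smulRight_apply, hnorm]
  refine ⟨f', hder, hb, fun x y => ?_⟩
  have h4 : f' x - f' y = (innerSL ℝ ξ).smulRight ((f x - f y) * Complex.I) := by
    ext z; simp [f']; ring
  rw [h4, ContinuousLinearMap.norm_smulRight_apply, norm_mul, Complex.norm_I, mul_one,
    innerSL_apply_norm, mul_assoc]
  refine mul_le_mul_of_nonneg_left ?_ (norm_nonneg _)
  exact Convex.norm_image_sub_le_of_norm_hasFDerivWithin_le (s := univ)
    (fun z _ => (hder z).hasFDerivWithinAt) (fun z _ => hb z) convex_univ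
    (mem_univ y) (mem_univ x)

section ContinuityEquation

variable {d : ℕ} {Ω : Type*} [MeasurableSpace Ω] {π : Measure Ω} [IsProbabilityMeasure π]
  {Z₀ W : Ω → State d}

/-- To first order in `δ` the integrands differ by `δ • f' z (W - B z)`. By `horth`, `W` may be
replaced by `b z` under the integral, which leaves an error of size `ε`; the Taylor remainders are
quadratic in `δ` and dominated by `q`. -/
lemma norm_integral_eulerStep_sub_le {b B : State d → State d} {f : State d → ℂ}
    {f' : State d → State d →L[ℝ] ℂ} {L H C ε δ s : ℝ} {q : Ω → ℝ}
    (hZ₀ : AEMeasurable Z₀ π) (hW : AEMeasurable W π)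
    (hf : HasBoundedC11 f f' L H) (hH : 0 ≤ H) (hfC : ∀ x, ‖f x‖ ≤ C)
    (hb : Continuous b) (hB : Continuous B) (hBb : ∀ x, ‖B x - b x‖ ≤ ε) (hδ : 0 ≤ δ)
    (hq : Integrable q π)
    (hle : ∀ ω, ‖B (Z₀ ω + s • W ω)‖ ^ 2 + ‖W ω‖ ^ 2 ≤ q ω)
    (horth : ∫ ω, f' (Z₀ ω + s • W ω) (b (Z₀ ω + s • W ω) - W ω) ∂π = 0) :
    ‖∫ ω, f (Z₀ ω + (s + δ) • W ω) ∂π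
      - ∫ ω, f (Z₀ ω + s • W ω + δ • B (Z₀ ω + s • W ω)) ∂π‖ ≤
      δ * (L * ε) + H * δ ^ 2 * ∫ ω, q ω ∂π := by
  have hL := hf.nonneg
  have hε : 0 ≤ ε := (norm_nonneg _).trans (hBb 0)
  have hZm : ∀ t : ℝ, AEMeasurable (fun ω => Z₀ ω + t • W ω) π := fun t =>
    hZ₀.add (hW.const_smul t)
  have hint : ∀ {g : Ω → State d}, AEMeasurable g π → Integrable (fun ω => f (g ω)) π :=
    fun hg => Integrable.of_bound
      (hf.continuous.measurable.comp_aemeasurable hg).aestronglyMeasurable C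
      (Filter.Eventually.of_forall fun ω => hfC _)
  have i1 := hint (hZm (s + δ))
  have i2 : Integrable (fun ω => f (Z₀ ω + s • W ω + δ • B (Z₀ ω + s • W ω))) π :=
    hint ((hZm s).add ((hB.measurable.comp_aemeasurable (hZm s)).const_smul δ))
  have i3 : Integrable (fun ω => f' (Z₀ ω + s • W ω) (b (Z₀ ω + s • W ω) - W ω)) π := by
    refine Integrable.mono' ((hq.add (integrable_const (1 + ε))).const_mul L) ?_
      (Filter.Eventually.of_forall fun ω => ?_)
    · have m1 : AEStronglyMeasurable (fun ω => f' (Z₀ ω + s • W ω)) π :=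
        hf.continuous_deriv.comp_aestronglyMeasurable (hZm s).aestronglyMeasurable
      have m2 : AEStronglyMeasurable (fun ω => b (Z₀ ω + s • W ω) - W ω) π :=
        (hb.comp_aestronglyMeasurable (hZm s).aestronglyMeasurable).sub hW.aestronglyMeasurable
      exact isBoundedBilinearMap_apply.continuous.comp_aestronglyMeasurable (m1.prodMk m2)
    · refine (ContinuousLinearMap.le_opNorm _ _).trans ?_
      refine mul_le_mul (hf.norm_le _) ?_ (norm_nonneg _) hL
      set z := Z₀ ω + s • W ω
      have h1 : ‖b z‖ ≤ ‖B z‖ + ε := by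
        have := norm_sub_le (B z) (B z - b z)
        rw [sub_sub_cancel] at this
        linarith [hBb z]
      have h2 := norm_sub_le (b z) (W ω)
      simp only [Pi.add_apply]
      -- Uses `x ≤ (x² + 1) / 2` for `‖B z‖` and `‖W ω‖`.
      nlinarith [hle ω, sq_nonneg (‖B z‖ - 1), sq_nonneg (‖W ω‖ - 1)]
  rw [← integral_sub i1 i2]
  have e : ∫ ω, (f (Z₀ ω + (s + δ) • W ω)
        - f (Z₀ ω + s • W ω + δ • B (Z₀ ω + s • W ω))) ∂π =
      ∫ ω, ((f (Z₀ ω + (s + δ) • W ω) - f (Z₀ ω + s • W ω + δ • B (Z₀ ω + s • W ω)))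
        + δ • f' (Z₀ ω + s • W ω) (b (Z₀ ω + s • W ω) - W ω)) ∂π := by
    refine Eq.trans ?_ (integral_add (i1.sub i2) (i3.smul δ)).symm
    simp only [Pi.smul_apply, integral_smul, horth, smul_zero, add_zero, Pi.sub_apply]
  rw [e]
  refine (norm_integral_le_of_norm_le (g := fun ω => δ * (L * ε) + H * δ ^ 2 * q ω)
    ((integrable_const _).add (hq.const_mul _)) (Filter.Eventually.of_forall fun ω => ?_)).trans
    (le_of_eq ?_)
  · set z := Z₀ ω + s • W ω with hz
    have hzδ : Z₀ ω + (s + δ) • W ω = z + δ • W ω := by rw [hz, add_smul, add_assoc]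
    have t1 := hf.norm_taylor_le hH z (δ • W ω)
    have t2 := hf.norm_taylor_le hH z (δ • B z)
    have t3 : ‖f' z (b z - B z)‖ ≤ L * ε := by
      refine (ContinuousLinearMap.le_opNorm _ _).trans ?_
      refine mul_le_mul (hf.norm_le _) ?_ (norm_nonneg _) hL
      rw [norm_sub_rev]; exact hBb z
    rw [norm_smul, Real.norm_eq_abs, abs_of_nonneg hδ] at t1 t2
    have : f (Z₀ ω + (s + δ) • W ω) - f (z + δ • B z) + δ • f' z (b z - W ω) =
        (f (z + δ • W ω) - f z - f' z (δ • W ω)) - (f (z + δ • B z) - f z - f' z (δ • B z))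
        + δ • f' z (b z - B z) := by
      rw [hzδ]
      simp only [map_smul, map_sub, smul_sub]
      abel
    rw [this]
    refine (norm_add_le _ _).trans ((add_le_add (norm_sub_le _ _) le_rfl).trans ?_)
    rw [norm_smul, Real.norm_eq_abs, abs_of_nonneg hδ]
    have h4 : H * δ ^ 2 * (‖B z‖ ^ 2 + ‖W ω‖ ^ 2) ≤ H * δ ^ 2 * q ω :=
      mul_le_mul_of_nonneg_left (hle ω) (by positivity)
    have h5 := mul_le_mul_of_nonneg_left t3 hδ
    nlinarith
  · rw [integral_add (integrable_const _) (hq.const_mul _)]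
    simp [integral_const_mul]

/-- Telescoping over the grid: at each time the one-step estimate is applied to `f` composed with
the Euler steps still to come. Hypothesis `hf` bounds all these composites by the same `L` and `H`,
so the errors simply add up. -/
lemma norm_integral_eulerIter_sub_le {b B : ℝ → State d → State d} {f : State d → ℂ}
    {L H C ε δ : ℝ} {q : Ω → ℝ} (hZ₀ : AEMeasurable Z₀ π) (hW : AEMeasurable W π)
    (hH : 0 ≤ H) (hδ : 0 ≤ δ)
    (hf : ∀ (j : ℕ) (s : ℝ), 0 ≤ s → s + j * δ ≤ 1 →
      ∃ f', HasBoundedC11 (fun x => f (eulerIter B δ j s x)) f' L H)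
    (hfC : ∀ x, ‖f x‖ ≤ C)
    (hb : ∀ s ∈ Icc (0 : ℝ) 1, Continuous (b s)) (hB : ∀ s ∈ Icc (0 : ℝ) 1, Continuous (B s))
    (hBb : ∀ s ∈ Icc (0 : ℝ) 1, ∀ x, ‖B s x - b s x‖ ≤ ε) (hq : Integrable q π)
    (hle : ∀ s ∈ Icc (0 : ℝ) 1, ∀ ω, ‖B s (Z₀ ω + s • W ω)‖ ^ 2 + ‖W ω‖ ^ 2 ≤ q ω)
    (horth : ∀ s ∈ Icc (0 : ℝ) 1, ∀ G : State d → State d →L[ℝ] ℂ, Continuous G →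
      (∃ C, ∀ x, ‖G x‖ ≤ C) →
      ∫ ω, G (Z₀ ω + s • W ω) (b s (Z₀ ω + s • W ω) - W ω) ∂π = 0)
    (j : ℕ) (s : ℝ) (hs : 0 ≤ s) (hj : s + j * δ ≤ 1) :
    ‖∫ ω, f (Z₀ ω + (s + j * δ) • W ω) ∂π
      - ∫ ω, f (eulerIter B δ j s (Z₀ ω + s • W ω)) ∂π‖ ≤
      j * (δ * (L * ε) + H * δ ^ 2 * ∫ ω, q ω ∂π) := by
  induction j generalizing s with
  | zero => simp [eulerIter]
  | succ j ih =>
    push_cast at hj ⊢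
    have hjδ : 0 ≤ j * δ := by positivity
    have hs1 : s ∈ Icc (0 : ℝ) 1 := ⟨hs, by nlinarith⟩
    have k1 := ih (s + δ) (by linarith) (by linarith)
    obtain ⟨g, hg⟩ := hf j (s + δ) (by linarith) (by linarith)
    have k2 := norm_integral_eulerStep_sub_le hZ₀ hW hg hH (fun x => hfC _) (hb s hs1)
      (hB s hs1) (hBb s hs1) hδ hq (hle s hs1)
      (horth s hs1 g hg.continuous_deriv ⟨L, hg.norm_le⟩)
    rw [show s + (j + 1) * δ = s + δ + j * δ by ring]
    simp only [eulerIter]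
    refine (norm_sub_le_norm_sub_add_norm_sub _ _ _).trans ((add_le_add k1 k2).trans ?_)
    exact le_of_eq (by ring)

end ContinuityEquation

/-- Euler schemes of vanishing step size, for fields converging uniformly to `b`, converge to the
trajectories of `b`. -/
lemma tendsto_eulerIter {d : ℕ} {b : ℝ → State d → State d} {B : ℕ → ℝ → State d → State d}
    {K : ℝ} (hK : 0 ≤ K) {ε : ℕ → ℝ} (hε0 : ∀ n, 0 ≤ ε n)
    (hε : Filter.Tendsto ε Filter.atTop (nhds 0))
    (hB : ∀ n, ∀ s ∈ Icc (0 : ℝ) 1, ∀ x x', ‖B n s x - B n s x'‖ ≤ K * ‖x - x'‖)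
    (hBb : ∀ n, ∀ s ∈ Icc (0 : ℝ) 1, ∀ x, ‖B n s x - b s x‖ ≤ ε n)
    {y : ℝ → State d} (hy : ∀ s ∈ Icc (0 : ℝ) 1, HasDerivWithinAt y (b s (y s)) (Icc 0 1) s)
    (hby : ContinuousOn (fun s => b s (y s)) (Icc 0 1))
    {T : ℝ} (hT : T ∈ Icc (0 : ℝ) 1) {N : ℕ → ℕ} (hN : ∀ n, n + 1 ≤ N n) :
    Filter.Tendsto (fun n => eulerIter (B n) (T / N n) (N n) 0 (y 0)) Filter.atTop
      (nhds (y T)) := by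
  rw [Metric.tendsto_atTop]
  intro r hr
  have hE := Real.exp_pos K
  have huc := isCompact_Icc.uniformContinuousOn_of_continuous hby
  rw [Metric.uniformContinuousOn_iff_le] at huc
  -- The final bound is `Real.exp K * (η + η) = r / 2`.
  set η := r / (4 * Real.exp K) with hη
  have hη0 : 0 < η := by positivity
  obtain ⟨δ₀, hδ₀, hosc⟩ := huc η hη0
  obtain ⟨n₁, hn₁⟩ := (Metric.tendsto_atTop.1 hε) η hη0
  obtain ⟨n₂, hn₂⟩ := exists_nat_one_div_lt hδ₀
  refine ⟨max n₁ n₂, fun n hn => ?_⟩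
  have hNpos : (0 : ℝ) < N n := by
    have := hN n
    exact_mod_cast (by omega : 0 < N n)
  have hNT : (N n : ℝ) * (T / N n) = T := by field_simp
  have hδ0 : 0 ≤ T / N n := div_nonneg hT.1 hNpos.le
  have hδ1 : T / N n ≤ δ₀ := by
    refine le_trans ?_ hn₂.le
    have h1 : (n₂ : ℝ) + 1 ≤ N n := by
      have := hN n
      have := le_max_right n₁ n₂
      exact_mod_cast (by omega : n₂ + 1 ≤ N n)
    exact div_le_div₀ zero_le_one hT.2 (by positivity) h1
  have key := norm_sub_eulerIter_le (δ := T / N n) hK (hε0 n) hη0.le hδ0 (hB n) (hBb n) hy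
    (fun s hs t ht hst => by
      rw [← dist_eq_norm]
      exact hosc t ht s hs (by rw [Real.dist_eq]; exact hst.trans hδ1)) (N n) 0 le_rfl
    (by rw [hNT]; linarith [hT.2]) (y 0)
  rw [hNT, sub_self, norm_zero, zero_add, zero_add] at key
  rw [dist_eq_norm, norm_sub_rev]
  have h2 : ε n < η := by
    have := hn₁ n (le_trans (le_max_left _ _) hn)
    rw [Real.dist_eq, sub_zero] at this
    exact (le_abs_self _).trans_lt this
  calc _ ≤ Real.exp (T * K) * (T * (ε n + η)) := key
    _ ≤ Real.exp K * (1 * (η + η)) := by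
      have := hε0 n
      have hT0 := hT.1
      have hT1 := hT.2
      gcongr
      nlinarith
    _ = r / 2 := by rw [hη]; field_simp; ring
    _ < r := by linarith

/-- Uniqueness for the continuity equation with a Lipschitz velocity field: if the straight lines
`Z₀ + s W` have conditional mean velocity `b s` given their position, then their marginals are
transported by the flow of `b`. -/
theorem hasLaw_of_conditional_velocity {d : ℕ} {Ω : Type*} [MeasurableSpace Ω] {π : Measure Ω}
    [IsProbabilityMeasure π] {Z₀ W : Ω → State d} (hZ₀ : MemLp Z₀ 2 π) (hW : MemLp W 2 π)
    {b : ℝ → State d → State d} {K : ℝ≥0} (hlip : ∀ s ∈ Icc (0 : ℝ) 1, LipschitzWith K (b s))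
    (hcont : ContinuousOn (fun z : ℝ × State d => b z.1 z.2) (Icc 0 1 ×ˢ univ))
    (horth : ∀ s ∈ Icc (0 : ℝ) 1, ∀ G : State d → State d →L[ℝ] ℂ, Continuous G →
      (∃ C, ∀ x, ‖G x‖ ≤ C) →
      ∫ ω, G (Z₀ ω + s • W ω) (b s (Z₀ ω + s • W ω) - W ω) ∂π = 0)
    {Ω' : Type*} [MeasurableSpace Ω'] {P' : Measure Ω'} {X : ℝ → Ω' → State d}
    (hX₀ : HasLaw (X 0) (π.map Z₀) P')
    (hX : ∀ᵐ ω ∂P', ∀ s ∈ Icc (0 : ℝ) 1,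
      HasDerivWithinAt (fun s => X s ω) (b s (X s ω)) (Icc 0 1) s)
    {T : ℝ} (hT : T ∈ Icc (0 : ℝ) 1) :
    HasLaw (X T) (π.map fun ω => Z₀ ω + T • W ω) P' := by
  have hZm := hZ₀.aestronglyMeasurable.aemeasurable
  have hWm := hW.aestronglyMeasurable.aemeasurable
  have hprobZ : IsProbabilityMeasure (π.map Z₀) := Measure.isProbabilityMeasure_map hZm
  have hprob : IsProbabilityMeasure P' := hX₀.isProbabilityMeasure_iff.2 hprobZ
  -- a uniform bound at the origin
  obtain ⟨C₀, hC₀⟩ : ∃ C₀, ∀ s ∈ Icc (0 : ℝ) 1, ‖b s 0‖ ≤ C₀ := by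
    refine isCompact_Icc.exists_bound_of_continuousOn (f := fun s => b s 0) ?_
    exact hcont.comp (f := fun s : ℝ => (s, (0 : State d))) (by fun_prop) fun s hs => ⟨hs, trivial⟩
  have hC₀0 : 0 ≤ C₀ := (norm_nonneg _).trans (hC₀ 0 ⟨le_rfl, zero_le_one⟩)
  -- regular approximations
  set ε : ℕ → ℝ := fun n => 1 / ((n : ℝ) + 1) with hε
  have hεpos : ∀ n, 0 < ε n := fun n => by positivity
  have hε1 : ∀ n, ε n ≤ 1 := fun n => by
    rw [hε]; exact div_le_one_of_le₀ (by linarith [n.cast_nonneg (α := ℝ)]) (by positivity)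
  have hεlim : Filter.Tendsto ε Filter.atTop (nhds 0) := tendsto_one_div_add_atTop_nhds_zero_nat
  choose M hM0 hM using fun n => exists_hasBoundedC11_approx (d := d) K (hεpos n)
  -- Times outside `[0, 1]` are never visited; the zero field is a default there.
  have hBex : ∀ n s, ∃ B : State d → State d, s ∈ Icc (0 : ℝ) 1 →
      (∃ B', HasBoundedC11 B B' K (M n)) ∧ ∀ x, ‖B x - b s x‖ ≤ ε n := fun n s => by
    by_cases hs : s ∈ Icc (0 : ℝ) 1
    · obtain ⟨B, B', h1, h2⟩ := hM n (b s) (hlip s hs)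
      exact ⟨B, fun _ => ⟨⟨B', h1⟩, h2⟩⟩
    · exact ⟨0, fun h => absurd h hs⟩
  choose B hBspec using hBex
  have hBc : ∀ n, ∀ s ∈ Icc (0 : ℝ) 1, Continuous (B n s) := fun n s hs => by
    obtain ⟨B', h⟩ := (hBspec n s hs).1
    exact h.continuous
  have hBlip : ∀ n, ∀ s ∈ Icc (0 : ℝ) 1, ∀ x x', ‖B n s x - B n s x'‖ ≤ K * ‖x - x'‖ :=
    fun n s hs x x' => by
      obtain ⟨B', h⟩ := (hBspec n s hs).1
      exact h.norm_sub_le x x'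
  have hBb : ∀ n, ∀ s ∈ Icc (0 : ℝ) 1, ∀ x, ‖B n s x - b s x‖ ≤ ε n :=
    fun n s hs => (hBspec n s hs).2
  -- second moments
  set q : Ω → ℝ := fun ω => (C₀ + 1 + K * (‖Z₀ ω‖ + ‖W ω‖)) ^ 2 + ‖W ω‖ ^ 2 with hqdef
  have hq : Integrable q π := by
    refine Integrable.add (MemLp.integrable_sq ?_) hW.norm.integrable_sq
    exact (memLp_const (C₀ + 1)).add ((hZ₀.norm.add hW.norm).const_mul (K : ℝ))
  -- One integrable majorant for all `n` and `s`: `C₀` bounds the field at the origin, `K` gives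
  -- linear growth, and the summand 1 in `q` absorbs `ε n`.
  have hle : ∀ n, ∀ s ∈ Icc (0 : ℝ) 1, ∀ ω,
      ‖B n s (Z₀ ω + s • W ω)‖ ^ 2 + ‖W ω‖ ^ 2 ≤ q ω := fun n s hs ω => by
    refine add_le_add (pow_le_pow_left₀ (norm_nonneg _) ?_ 2) le_rfl
    set z := Z₀ ω + s • W ω with hz
    have h1 : ‖z‖ ≤ ‖Z₀ ω‖ + ‖W ω‖ := by
      refine (norm_add_le _ _).trans (add_le_add le_rfl ?_)
      rw [norm_smul, Real.norm_eq_abs, abs_of_nonneg hs.1]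
      exact mul_le_of_le_one_left (norm_nonneg _) hs.2
    have h2 : ‖b s z - b s 0‖ ≤ K * ‖z‖ := by
      simpa using (hlip s hs).norm_sub_le z 0
    have h3 : ‖B n s z‖ ≤ ‖B n s z - b s z‖ + ‖b s z - b s 0‖ + ‖b s 0‖ := by
      have := norm_add₃_le (a := B n s z - b s z) (b := b s z - b s 0) (c := b s 0)
      simpa using this
    have h4 := mul_le_mul_of_nonneg_left h1 K.coe_nonneg
    linarith [hBb n s hs z, hC₀ s hs, hε1 n]
  set Q := ∫ ω, q ω ∂π with hQ
  have hQ0 : 0 ≤ Q := integral_nonneg fun ω => by positivity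
  -- continuity along trajectories
  have hXc : ∀ᵐ ω ∂P', ContinuousOn (fun s => b s (X s ω)) (Icc 0 1) := by
    filter_upwards [hX] with ω hω
    have h1 : ContinuousOn (fun s => X s ω) (Icc 0 1) := fun s hs => (hω s hs).continuousWithinAt
    exact hcont.comp (f := fun s => (s, X s ω)) (continuousOn_id.prodMk h1)
      fun s hs => ⟨hs, trivial⟩
  -- Euler maps preserve continuity
  have hiter : ∀ n (δ : ℝ), 0 ≤ δ → ∀ (j : ℕ) (s : ℝ), 0 ≤ s → s + j * δ ≤ 1 →
      Continuous (eulerIter (B n) δ j s) := fun n δ hδ j => by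
    induction j with
    | zero => intro s _ _; exact continuous_id
    | succ j ih =>
      intro s hs hj
      push_cast at hj
      have hjδ : 0 ≤ j * δ := by positivity
      exact (ih (s + δ) (by linarith) (by linarith)).comp
        (continuous_id.add ((hBc n s ⟨hs, by nlinarith⟩).const_smul δ))
  have hconv : ∀ N : ℕ → ℕ, (∀ n, n + 1 ≤ N n) → ∀ᵐ ω ∂P',
      Filter.Tendsto (fun n => eulerIter (B n) (T / N n) (N n) 0 (X 0 ω)) Filter.atTop
        (nhds (X T ω)) := fun N hN => by
    filter_upwards [hX, hXc] with ω h1 h2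
    exact tendsto_eulerIter (y := fun s => X s ω) K.coe_nonneg (fun n => (hεpos n).le) hεlim
      hBlip hBb h1 h2 hT hN
  have hcontN : ∀ (N : ℕ → ℕ) n, n + 1 ≤ N n →
      Continuous (eulerIter (B n) (T / N n) (N n) 0) := fun N n hN => by
    have hNpos : (0 : ℝ) < N n := by exact_mod_cast (by omega : 0 < N n)
    refine hiter n _ (div_nonneg hT.1 hNpos.le) _ _ le_rfl ?_
    rw [zero_add, mul_div_cancel₀ _ hNpos.ne']
    exact hT.2
  -- Only `X 0` is assumed measurable; `X T` inherits this as an almost sure limit of continuous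
  -- functions of `X 0`.
  have hXm : AEMeasurable (X T) P' :=
    aemeasurable_of_tendsto_metrizable_ae Filter.atTop
      (fun n => (hcontN (fun n => n + 1) n le_rfl).measurable.comp_aemeasurable hX₀.aemeasurable)
      (hconv (fun n => n + 1) fun n => le_rfl)
  have hZTm : AEMeasurable (fun ω => Z₀ ω + T • W ω) π := hZm.add (hWm.const_smul T)
  refine ⟨hXm, ?_⟩
  have := Measure.isProbabilityMeasure_map (μ := P') hXm
  have := Measure.isProbabilityMeasure_map (μ := π) hZTm
  refine Measure.ext_of_charFun (funext fun ξ => ?_)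
  set f : State d → ℂ := fun x => Complex.exp (inner ℝ x ξ * Complex.I) with hfdef
  obtain ⟨f', hf⟩ := hasBoundedC11_character ξ
  rw [← hfdef] at hf
  have hf1 : ∀ x, ‖f x‖ ≤ 1 := fun x => (Complex.norm_exp_ofReal_mul_I _).le
  have hfm : Measurable f := hf.continuous.measurable
  rw [charFun_apply, charFun_apply, integral_map hXm hfm.aestronglyMeasurable,
    integral_map hZTm hfm.aestronglyMeasurable]
  change ∫ ω, f (X T ω) ∂P' = ∫ ω, f (Z₀ ω + T • W ω) ∂π
  -- constants for the C^{1,1} bounds and a sufficiently fine grid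
  set L' := ‖ξ‖ * Real.exp K with hL'
  set H' : ℕ → ℝ := fun n =>
    Real.exp (2 * K) * (‖ξ‖ * ‖ξ‖ + M n * (‖ξ‖ * Real.exp K)) with hH'
  have hH'0 : ∀ n, 0 ≤ H' n := fun n => by
    have := hM0 n
    positivity
  -- The second-order constant `H' n` may blow up as the mollification is refined, so the grid is
  -- chosen after it: the ceiling forces `H' n * Q / N n ≤ ε n`, and `n + 1` forces the step size to
  -- zero.
  set N : ℕ → ℕ := fun n => max (n + 1) ⌈H' n * Q * ((n : ℝ) + 1)⌉₊ with hN
  have hN1 : ∀ n, n + 1 ≤ N n := fun n => le_max_left _ _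
  have hN2 : ∀ n, H' n * Q * ((n : ℝ) + 1) ≤ N n := fun n =>
    (Nat.le_ceil _).trans (Nat.cast_le.2 (le_max_right _ _))
  have hNpos : ∀ n, (0 : ℝ) < N n := fun n => by
    have := hN1 n
    exact_mod_cast (by omega : 0 < N n)
  have hest : ∀ n, ‖∫ ω, f (Z₀ ω + T • W ω) ∂π
      - ∫ ω, f (eulerIter (B n) (T / N n) (N n) 0 (Z₀ ω)) ∂π‖ ≤ L' * ε n + ε n := fun n => by
    set δ := T / N n with hδ
    have hδ0 : 0 ≤ δ := div_nonneg hT.1 (hNpos n).le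
    have hNδ : (N n : ℝ) * δ = T := mul_div_cancel₀ _ (hNpos n).ne'
    have key := norm_integral_eulerIter_sub_le (B := B n) (f := f) (L := L') (H := H' n) (δ := δ)
      hZm hWm (hH'0 n) hδ0 (fun j s hs hj => by
        obtain ⟨g, hg⟩ := hf.comp_eulerIter (B := B n) (by positivity) K.coe_nonneg (hM0 n) hδ0
          (fun s hs => (hBspec n s hs).1) j s hs hj
        have hjδ : (j : ℝ) * δ ≤ 1 := by linarith
        have hjδ0 : 0 ≤ (j : ℝ) * δ := by positivity
        have hjK : (j : ℝ) * δ * K ≤ K := mul_le_of_le_one_left K.coe_nonneg hjδ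
        have := hM0 n
        refine ⟨g, hg.mono ?_ ?_⟩
        · rw [hL']; gcongr
        · simp only [hH']
          exact mul_le_mul (Real.exp_le_exp.2 (by linarith))
            (add_le_add le_rfl (mul_le_of_le_one_left (by positivity) hjδ)) (by positivity)
            (by positivity))
      hf1 (fun s hs => (hlip s hs).continuous) (hBc n) (hBb n) hq (hle n) horth (N n) 0 le_rfl
      (by rw [hNδ, zero_add]; exact hT.2)
    simp only [hNδ, zero_add, zero_smul, add_zero] at key
    refine key.trans ?_
    have e1 : (N n : ℝ) * (δ * (L' * ε n) + H' n * δ ^ 2 * Q) =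
        T * (L' * ε n) + T ^ 2 * (H' n * Q / N n) := by
      have := (hNpos n).ne'
      rw [hδ]; field_simp
    rw [e1]
    have e2 : H' n * Q / N n ≤ ε n := by
      have h3 := hN2 n
      rw [hε, div_le_div_iff₀ (hNpos n) (by positivity)]
      linarith
    have e3 : 0 ≤ H' n * Q / N n := div_nonneg (mul_nonneg (hH'0 n) hQ0) (hNpos n).le
    have e4 : 0 ≤ L' * ε n := mul_nonneg (by positivity) (hεpos n).le
    have e5 : T ^ 2 ≤ 1 := pow_le_one₀ hT.1 hT.2
    have e6 := mul_le_of_le_one_left e4 hT.2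
    have e7 := mul_le_of_le_one_left e3 e5
    linarith
  have hsame : ∀ n, ∫ ω, f (eulerIter (B n) (T / N n) (N n) 0 (Z₀ ω)) ∂π =
      ∫ ω, f (eulerIter (B n) (T / N n) (N n) 0 (X 0 ω)) ∂P' := fun n => by
    have hg : Measurable fun x => f (eulerIter (B n) (T / N n) (N n) 0 x) :=
      hfm.comp (hcontN N n (hN1 n)).measurable
    rw [← integral_map (f := fun x => f (eulerIter (B n) (T / N n) (N n) 0 x)) hZm
      hg.aestronglyMeasurable, ← hX₀.map_eq, integral_map hX₀.aemeasurable hg.aestronglyMeasurable]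
  have lim1 : Filter.Tendsto (fun n => ∫ ω, f (eulerIter (B n) (T / N n) (N n) 0 (X 0 ω)) ∂P')
      Filter.atTop (nhds (∫ ω, f (X T ω) ∂P')) := by
    refine tendsto_integral_of_dominated_convergence (fun _ => 1) (fun n => ?_)
      (integrable_const _) (fun n => Filter.Eventually.of_forall fun ω => hf1 _) ?_
    · exact (hfm.comp (hcontN N n (hN1 n)).measurable).comp_aemeasurable hX₀.aemeasurable
        |>.aestronglyMeasurable
    · filter_upwards [hconv N hN1] with ω hω
      exact (hf.continuous.tendsto _).comp hω
  have lim2 : Filter.Tendsto (fun n => ∫ ω, f (eulerIter (B n) (T / N n) (N n) 0 (X 0 ω)) ∂P')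
      Filter.atTop (nhds (∫ ω, f (Z₀ ω + T • W ω) ∂π)) := by
    rw [tendsto_iff_norm_sub_tendsto_zero]
    refine squeeze_zero (fun n => norm_nonneg _) (fun n => ?_)
      (g := fun n => L' * ε n + ε n) ?_
    · rw [norm_sub_rev, ← hsame]; exact hest n
    · simpa using (hεlim.const_mul L').add hεlim
  exact tendsto_nhds_unique lim1 lim2

/-! ### Well-posedness of the ODE -/

section ODE

variable {E : Type*} [NormedAddCommGroup E] [NormedSpace ℝ E]

/-- Solutions on adjacent intervals can be glued. -/
lemma exists_solution_glue {f : ℝ → E → E} {a b c : ℝ} (hab : a ≤ b) (hbc : b ≤ c) {y z : ℝ → E}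
    (hy : ∀ t ∈ Icc a b, HasDerivWithinAt y (f t (y t)) (Icc a b) t)
    (hz : ∀ t ∈ Icc b c, HasDerivWithinAt z (f t (z t)) (Icc b c) t) (hyz : z b = y b) :
    ∃ w : ℝ → E, w a = y a ∧ ∀ t ∈ Icc a c, HasDerivWithinAt w (f t (w t)) (Icc a c) t := by
  set w : ℝ → E := fun t => if t ≤ b then y t else z t with hw
  have w1 : ∀ t ∈ Icc a b, w t = y t := fun t ht => if_pos ht.2
  have w2 : ∀ t ∈ Icc b c, w t = z t := fun t ht => by
    rcases ht.1.eq_or_lt with h | h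
    · rw [← h, hyz]; exact if_pos le_rfl
    · exact if_neg (not_le.2 h)
  refine ⟨w, w1 a ⟨le_rfl, hab⟩, fun t ht => ?_⟩
  rw [← Icc_union_Icc_eq_Icc hab hbc]
  -- On the closed piece not containing `t` the derivative condition is vacuous; at the junction
  -- both pieces contribute.
  refine HasDerivWithinAt.union ?_ ?_
  · by_cases h : t ∈ Icc a b
    · rw [w1 t h]
      exact (hy t h).congr w1 (w1 t h)
    · exact HasFDerivWithinAt.of_notMem_closure (by rwa [isClosed_Icc.closure_eq])
  · by_cases h : t ∈ Icc b c
    · rw [w2 t h]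
      exact (hz t h).congr w2 (w2 t h)
    · exact HasFDerivWithinAt.of_notMem_closure (by rwa [isClosed_Icc.closure_eq])

/-- Global existence on `[0, 1]` for a globally Lipschitz field. -/
lemma exists_solution_of_lipschitz [CompleteSpace E] {f : ℝ → E → E} {K : ℝ≥0}
    (hlip : ∀ t ∈ Icc (0 : ℝ) 1, LipschitzWith K (f t))
    (hcont : ∀ x, ContinuousOn (fun t => f t x) (Icc 0 1)) (x : E) :
    ∃ y : ℝ → E, y 0 = x ∧ ∀ t ∈ Icc (0 : ℝ) 1, HasDerivWithinAt y (f t (y t)) (Icc 0 1) t := by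
  obtain ⟨C, hC⟩ := isCompact_Icc.exists_bound_of_continuousOn (hcont 0)
  have hC0 : 0 ≤ C := (norm_nonneg _).trans (hC 0 ⟨le_rfl, zero_le_one⟩)
  -- With `A = C + K * ‖x₀‖`, the field is at most `(2 * K + 1) * A` on the ball of radius `2 * A`
  -- about `x₀`. Steps of length `1 / N` thus stay inside it for every `x₀`, and `N` of them cover
  -- `[0, 1]`.
  obtain ⟨N, hN⟩ := exists_nat_ge (2 * (K : ℝ) + 1)
  have hNpos : (0 : ℝ) < N := by linarith [K.coe_nonneg]
  have hloc : ∀ s δ : ℝ, 0 ≤ s → 0 ≤ δ → δ ≤ 1 / N → s + δ ≤ 1 → ∀ x₀ : E, ∃ z : ℝ → E, z s = x₀ ∧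
      ∀ t ∈ Icc s (s + δ), HasDerivWithinAt z (f t (z t)) (Icc s (s + δ)) t := by
    intro s δ hs hδ hδN hs1 x₀
    have hsub : Icc s (s + δ) ⊆ Icc 0 1 := Icc_subset_Icc hs hs1
    have hA : 0 ≤ C + K * ‖x₀‖ := by positivity
    let a : ℝ≥0 := ⟨2 * (C + K * ‖x₀‖), by positivity⟩
    let M : ℝ≥0 := ⟨C + K * (‖x₀‖ + 2 * (C + K * ‖x₀‖)), by positivity⟩
    have hδK : δ * (2 * K + 1) ≤ 1 := by
      calc δ * (2 * K + 1) ≤ 1 / N * N := by gcongr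
        _ = 1 := by field_simp
    have hPL : IsPicardLindelof f (tmin := s) (tmax := s + δ) ⟨s, le_rfl, by linarith⟩ x₀ a 0 M K :=
      { lipschitzOnWith := fun t ht => (hlip t (hsub ht)).lipschitzOnWith
        continuousOn := fun z _ => (hcont z).mono hsub
        norm_le := fun t ht z hz => by
          have h1 : ‖f t z - f t 0‖ ≤ K * ‖z‖ := by
            simpa using (hlip t (hsub ht)).norm_sub_le z 0
          have h2 : ‖z‖ ≤ ‖x₀‖ + 2 * (C + K * ‖x₀‖) := by
            have h3 : ‖z - x₀‖ ≤ 2 * (C + K * ‖x₀‖) := by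
              rw [← dist_eq_norm]; exact hz
            have h4 := norm_add_le x₀ (z - x₀)
            rw [add_sub_cancel] at h4
            linarith
          have h3 := norm_add_le (f t z - f t 0) (f t 0)
          rw [sub_add_cancel] at h3
          have h4 := mul_le_mul_of_nonneg_left h2 K.coe_nonneg
          change ‖f t z‖ ≤ C + K * (‖x₀‖ + 2 * (C + K * ‖x₀‖))
          linarith [hC t (hsub ht)]
        mul_max_le := by
          change (C + K * (‖x₀‖ + 2 * (C + K * ‖x₀‖))) * max (s + δ - s) (s - s) ≤
            2 * (C + K * ‖x₀‖) - 0
          rw [add_sub_cancel_left, sub_self, max_eq_left hδ]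
          nlinarith [mul_le_mul_of_nonneg_right hδK hA] }
    exact hPL.exists_eq_forall_mem_Icc_hasDerivWithinAt₀
  have hglob : ∀ k : ℕ, k ≤ N → ∃ y : ℝ → E, y 0 = x ∧
      ∀ t ∈ Icc (0 : ℝ) (k / N), HasDerivWithinAt y (f t (y t)) (Icc 0 (k / N)) t := by
    intro k
    induction k with
    | zero =>
      intro _
      obtain ⟨z, h1, h2⟩ := hloc 0 0 le_rfl le_rfl (by positivity) (by norm_num) x
      exact ⟨z, h1, by simpa using h2⟩
    | succ k ih =>
      intro hk
      obtain ⟨y, hy0, hy⟩ := ih (by omega)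
      have hk1 : (k : ℝ) / N + 1 / N ≤ 1 := by
        rw [← add_div, div_le_one hNpos]; exact_mod_cast hk
      obtain ⟨z, hz0, hz⟩ := hloc (k / N) (1 / N) (by positivity) (by positivity) le_rfl hk1
        (y (k / N))
      obtain ⟨w, hw0, hw⟩ := exists_solution_glue (by positivity)
        (by linarith [show (0 : ℝ) ≤ 1 / N by positivity]) hy hz hz0
      refine ⟨w, hw0.trans hy0, ?_⟩
      rw [Nat.cast_succ, add_div]
      exact hw
  simpa [div_self hNpos.ne'] using hglob N le_rfl

/-- Uniqueness on `[0, 1]` for a globally Lipschitz field. -/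
lemma eqOn_solution_of_lipschitz {f : ℝ → E → E} {K : ℝ≥0}
    (hlip : ∀ t ∈ Icc (0 : ℝ) 1, LipschitzWith K (f t)) {y z : ℝ → E}
    (hy : ∀ t ∈ Icc (0 : ℝ) 1, HasDerivWithinAt y (f t (y t)) (Icc 0 1) t)
    (hz : ∀ t ∈ Icc (0 : ℝ) 1, HasDerivWithinAt z (f t (z t)) (Icc 0 1) t) (h0 : z 0 = y 0) :
    EqOn z y (Icc 0 1) := by
  have right : ∀ {w : ℝ → E}, (∀ t ∈ Icc (0 : ℝ) 1,
      HasDerivWithinAt w (f t (w t)) (Icc 0 1) t) →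
      ∀ t ∈ Ico (0 : ℝ) 1, HasDerivWithinAt w (f t (w t)) (Ici t) t := fun hw t ht =>
    (hw t (Ico_subset_Icc_self ht)).mono_of_mem_nhdsWithin
      (Filter.mem_of_superset (Icc_mem_nhdsGE ht.2) (Icc_subset_Icc_left ht.1))
  exact ODE_solution_unique_of_mem_Icc_right (s := fun _ => univ)
    (fun t ht => (hlip t (Ico_subset_Icc_self ht)).lipschitzOnWith)
    (fun t ht => (hz t ht).continuousWithinAt) (right hz) (fun _ _ => trivial)
    (fun t ht => (hy t ht).continuousWithinAt) (right hy) (fun _ _ => trivial) h0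

end ODE

/-! ### Least-squares regression and conditional means -/

lemma memLp_two_iff_lintegral_enorm_sq {Ω E : Type*} [MeasurableSpace Ω] [NormedAddCommGroup E]
    {μ : Measure Ω} {f : Ω → E} (hf : AEStronglyMeasurable f μ) :
    MemLp f 2 μ ↔ ∫⁻ ω, ‖f ω‖ₑ ^ 2 ∂μ < ∞ := by
  have := eLpNorm_lt_top_iff_lintegral_rpow_enorm_lt_top (f := f) (μ := μ) two_ne_zero
    ENNReal.ofNat_ne_top
  simp only [ENNReal.toReal_ofNat, ENNReal.rpow_ofNat] at this
  exact ⟨fun h => this.1 h.2, fun h => ⟨hf, this.2 h⟩⟩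

lemma lintegral_enorm_sq_eq_ofReal {Ω E : Type*} [MeasurableSpace Ω] [NormedAddCommGroup E]
    {μ : Measure Ω} {f : Ω → E} (hf : MemLp f 2 μ) :
    ∫⁻ ω, ‖f ω‖ₑ ^ 2 ∂μ = ENNReal.ofReal (∫ ω, ‖f ω‖ ^ 2 ∂μ) := by
  rw [ofReal_integral_eq_lintegral_ofReal hf.norm.integrable_sq
    (Filter.Eventually.of_forall fun ω => by positivity)]
  refine lintegral_congr fun ω => ?_
  rw [ENNReal.ofReal_pow (norm_nonneg _), ofReal_norm]

/-- Bias-variance decomposition of the mean square error. -/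
lemma lintegral_enorm_sub_smul_sq {d : ℕ} {ν : Measure (State d)} [IsProbabilityMeasure ν]
    (hν : ∫⁻ y, ‖y‖ₑ ^ 2 ∂ν < ∞) (c : State d) (a : ℝ) :
    ∫⁻ y, ‖c - a • y‖ₑ ^ 2 ∂ν =
      ‖c - a • ∫ y, y ∂ν‖ₑ ^ 2 + ∫⁻ y, ‖a • (∫ y, y ∂ν) - a • y‖ₑ ^ 2 ∂ν := by
  have hid : MemLp (fun y : State d => y) 2 ν :=
    (memLp_two_iff_lintegral_enorm_sq aestronglyMeasurable_id).2 hν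
  set m := ∫ y, y ∂ν with hm
  have hdev : ∀ e : State d, MemLp (fun y => e - a • y) 2 ν := fun e =>
    (memLp_const e).sub (hid.const_smul a)
  have hint : Integrable (fun y : State d => y) ν := hid.integrable one_le_two
  have hcross : ∫ y, (inner ℝ (c - a • m) (a • m - a • y) : ℝ) ∂ν = 0 := by
    rw [integral_inner ((hdev (a • m)).integrable one_le_two),
      integral_sub (f := fun _ => a • m) (g := fun y => a • y) (integrable_const _) (hint.smul a),
      integral_smul a (fun y : State d => y), ← hm]
    simp
  have key : ∫ y, ‖c - a • y‖ ^ 2 ∂ν = ‖c - a • m‖ ^ 2 + ∫ y, ‖a • m - a • y‖ ^ 2 ∂ν := by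
    have hpt : ∀ y, ‖c - a • y‖ ^ 2 = ‖c - a • m‖ ^ 2 +
        2 * (inner ℝ (c - a • m) (a • m - a • y) : ℝ) + ‖a • m - a • y‖ ^ 2 := fun y => by
      rw [← norm_add_sq_real, sub_add_sub_cancel]
    rw [integral_congr_ae (Filter.Eventually.of_forall hpt)]
    have i1 : Integrable (fun y => 2 * (inner ℝ (c - a • m) (a • m - a • y) : ℝ)) ν :=
      (((hdev (a • m)).integrable one_le_two).const_inner (c - a • m)).const_mul 2
    rw [integral_add (f := fun y => ‖c - a • m‖ ^ 2 +
        2 * (inner ℝ (c - a • m) (a • m - a • y) : ℝ)) ((integrable_const _).add i1)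
        (hdev (a • m)).norm.integrable_sq,
      integral_add (integrable_const _) i1, integral_const_mul, hcross]
    simp
  rw [lintegral_enorm_sq_eq_ofReal (hdev c), lintegral_enorm_sq_eq_ofReal (hdev (a • m)), key,
    ENNReal.ofReal_add (by positivity) (integral_nonneg fun _ => by positivity),
    ENNReal.ofReal_pow (norm_nonneg _), ofReal_norm]

section Disintegration

variable {d : ℕ} {μ : Measure (State d)} [IsProbabilityMeasure μ] {η : Kernel (State d) (State d)}

lemma measurable_kernel_mean : Measurable fun x => ∫ y, y ∂η x :=
  (stronglyMeasurable_id.integral_kernel (κ := η)).measurable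

variable [IsMarkovKernel η]

/-- Bias-variance decomposition of the regression error, conditionally on the regressor. -/
lemma lintegral_compProd_enorm_sub_smul_sq
    (hρ : ∫⁻ z, ‖z.2‖ₑ ^ 2 ∂(μ ⊗ₘ η) < ∞) {f : State d → State d} (hf : Measurable f) (a : ℝ) :
    ∫⁻ z, ‖f z.1 - a • z.2‖ₑ ^ 2 ∂(μ ⊗ₘ η) =
      ∫⁻ z, ‖f z.1 - a • ∫ y, y ∂η z.1‖ₑ ^ 2 ∂(μ ⊗ₘ η) +
        ∫⁻ z, ‖a • (∫ y, y ∂η z.1) - a • z.2‖ₑ ^ 2 ∂(μ ⊗ₘ η) := by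
  have hm : Measurable fun x => ∫ y, y ∂η x := measurable_kernel_mean
  have m1 : Measurable fun z : State d × State d => ‖f z.1 - a • ∫ y, y ∂η z.1‖ₑ ^ 2 := by
    have : Measurable fun z : State d × State d => ∫ y, y ∂η z.1 := hm.comp measurable_fst
    exact ((hf.comp measurable_fst).sub (this.const_smul a)).enorm.pow_const 2
  have m2 : Measurable fun z : State d × State d => ‖a • (∫ y, y ∂η z.1) - a • z.2‖ₑ ^ 2 := by
    have : Measurable fun z : State d × State d => ∫ y, y ∂η z.1 := hm.comp measurable_fst
    exact ((this.const_smul a).sub (measurable_snd.const_smul a)).enorm.pow_const 2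
  have hsnd : Measurable fun z : State d × State d => ‖z.2‖ₑ ^ 2 :=
    measurable_snd.enorm.pow_const 2
  rw [← lintegral_add_left m1,
    Measure.lintegral_compProd (f := fun z => ‖f z.1 - a • ∫ y, y ∂η z.1‖ₑ ^ 2 +
      ‖a • (∫ y, y ∂η z.1) - a • z.2‖ₑ ^ 2) (m1.add m2),
    Measure.lintegral_compProd (f := fun z => ‖f z.1 - a • z.2‖ₑ ^ 2)
      (((hf.comp measurable_fst).sub (measurable_snd.const_smul a)).enorm.pow_const 2)]
  rw [Measure.lintegral_compProd hsnd] at hρ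
  -- A finite total second moment makes almost every conditional second moment finite, and the
  -- decomposition is applied fibrewise there.
  refine lintegral_congr_ae ?_
  filter_upwards [ae_lt_top hsnd.lintegral_kernel_prod_right' hρ.ne] with x hx
  rw [lintegral_enorm_sub_smul_sq hx, lintegral_add_left measurable_const]
  simp

/-- The regression residual is orthogonal to functions of the regressor. -/
lemma integral_compProd_apply_mean_sub
    (hρ : ∫⁻ z, ‖z.2‖ₑ ^ 2 ∂(μ ⊗ₘ η) < ∞) {G : State d → State d →L[ℝ] ℂ} (hG : Continuous G)
    {C : ℝ} (hC : ∀ x, ‖G x‖ ≤ C) :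
    ∫ z, G z.1 ((∫ y, y ∂η z.1) - z.2) ∂(μ ⊗ₘ η) = 0 := by
  have hm : Measurable fun x => ∫ y, y ∂η x := measurable_kernel_mean
  have hr : Measurable fun z : State d × State d => (∫ y, y ∂η z.1) - z.2 :=
    (hm.comp measurable_fst).sub measurable_snd
  have hsnd : Measurable fun z : State d × State d => ‖z.2‖ₑ ^ 2 :=
    measurable_snd.enorm.pow_const 2
  have hL2 : MemLp (fun z : State d × State d => (∫ y, y ∂η z.1) - z.2) 2 (μ ⊗ₘ η) := by
    rw [memLp_two_iff_lintegral_enorm_sq hr.aestronglyMeasurable]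
    refine lt_of_le_of_lt ?_ hρ
    -- With `f = 0` and `a = 1`, the squared residual is one of the two summands of the second
    -- moment.
    have := lintegral_compProd_enorm_sub_smul_sq hρ (f := 0) measurable_const 1
    simp only [Pi.zero_apply, zero_sub, one_smul, enorm_neg] at this
    rw [this]
    exact le_add_self
  have hint : Integrable (fun z => G z.1 ((∫ y, y ∂η z.1) - z.2)) (μ ⊗ₘ η) := by
    refine Integrable.mono' ((hL2.integrable one_le_two).norm.const_mul C) ?_
      (Filter.Eventually.of_forall fun z => ?_)
    · exact isBoundedBilinearMap_apply.continuous.comp_aestronglyMeasurable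
        ((hG.measurable.comp measurable_fst).aestronglyMeasurable.prodMk hr.aestronglyMeasurable)
    · exact (ContinuousLinearMap.le_opNorm _ _).trans
        (mul_le_mul_of_nonneg_right (hC _) (norm_nonneg _))
  rw [Measure.integral_compProd hint]
  rw [Measure.lintegral_compProd hsnd] at hρ
  refine integral_eq_zero_of_ae ?_
  filter_upwards [ae_lt_top hsnd.lintegral_kernel_prod_right' hρ.ne] with x hx
  have hid : Integrable (fun y : State d => y) (η x) :=
    ((memLp_two_iff_lintegral_enorm_sq aestronglyMeasurable_id).2 hx).integrable one_le_two
  simp only [Pi.zero_apply]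
  have hsub : Integrable (fun y => (∫ y, y ∂η x) - y) (η x) := (integrable_const _).sub hid
  rw [ContinuousLinearMap.integral_comp_comm (G x) hsub, integral_sub (integrable_const _) hid]
  simp

end Disintegration

/-! ### The conditional velocity -/

/-- The interpolant of a pair. -/
def pairInterpolant {d : ℕ} (t : ℝ) (p : State d × State d) : State d :=
  (1 - t) • p.1 + t • p.2

lemma measurable_pairInterpolant {d : ℕ} :
    Measurable fun z : ℝ × State d × State d => pairInterpolant z.1 z.2 := by
  unfold pairInterpolant
  fun_prop

/-- The conditional mean of the displacement given the interpolant, jointly measurable in time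
and space. -/
lemma exists_conditional_velocity {d : ℕ} (π : Measure (State d × State d))
    [IsProbabilityMeasure π] (hπ : MemLp (fun p => p.2 - p.1) 2 π) :
    ∃ u : ℝ → State d → State d, Measurable (fun z : ℝ × State d => u z.1 z.2) ∧
      (∀ t (f : State d → State d), Measurable f → ∀ a : ℝ,
        ∫⁻ p, ‖f (pairInterpolant t p) - a • (p.2 - p.1)‖ₑ ^ 2 ∂π =
          ∫⁻ p, ‖f (pairInterpolant t p) - a • u t (pairInterpolant t p)‖ₑ ^ 2 ∂π +
          ∫⁻ p, ‖a • u t (pairInterpolant t p) - a • (p.2 - p.1)‖ₑ ^ 2 ∂π) ∧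
      ∀ t (G : State d → State d →L[ℝ] ℂ), Continuous G → (∃ C, ∀ x, ‖G x‖ ≤ C) →
        ∫ p, G (pairInterpolant t p) (u t (pairInterpolant t p) - (p.2 - p.1)) ∂π = 0 := by
  have hF : Measurable fun z : ℝ × State d × State d =>
      (pairInterpolant z.1 z.2, z.2.2 - z.2.1) :=
    measurable_pairInterpolant.prodMk (by fun_prop)
  have hFt : ∀ t : ℝ, Measurable fun p : State d × State d =>
      (pairInterpolant t p, p.2 - p.1) := fun t => hF.comp measurable_prodMk_left
  -- Disintegrating the kernel `t ↦ law of (x_t, x₁ - x₀)` all at once, instead of each law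
  -- separately, makes the conditional mean jointly measurable in `(t, x)`.
  let κ : Kernel ℝ (State d × State d) :=
    (Kernel.id ×ₖ Kernel.const ℝ π).map fun z => (pairInterpolant z.1 z.2, z.2.2 - z.2.1)
  have hκm : IsMarkovKernel κ := Kernel.IsMarkovKernel.map _ hF
  have hκ : ∀ t, κ t = π.map fun p => (pairInterpolant t p, p.2 - p.1) := fun t => by
    simp only [κ]
    rw [Kernel.map_apply _ hF, Kernel.prod_apply, Kernel.id_apply, Kernel.const_apply,
      Measure.dirac_prod, Measure.map_map hF measurable_prodMk_left]
    rfl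
  have hdis : ∀ t, (Kernel.fst κ t) ⊗ₘ (Kernel.sectR κ.condKernel t) =
      π.map fun p => (pairInterpolant t p, p.2 - p.1) := fun t => by
    rw [← hκ t, ← Kernel.compProd_apply_eq_compProd_sectR, Kernel.disintegrate]
  have hsnd : Measurable fun z : State d × State d => ‖z.2‖ₑ ^ 2 :=
    measurable_snd.enorm.pow_const 2
  have hfin : ∀ t, ∫⁻ z, ‖z.2‖ₑ ^ 2 ∂((Kernel.fst κ t) ⊗ₘ (Kernel.sectR κ.condKernel t)) < ∞ :=
    fun t => by
      rw [hdis t, lintegral_map hsnd (hFt t)]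
      exact (memLp_two_iff_lintegral_enorm_sq hπ.1).1 hπ
  refine ⟨fun t x => ∫ y, y ∂κ.condKernel (t, x), ?_, fun t f hf a => ?_, fun t G hG hC => ?_⟩
  · exact (stronglyMeasurable_id.integral_kernel (κ := κ.condKernel)).measurable
  · have key := lintegral_compProd_enorm_sub_smul_sq (hfin t) hf a
    have hm : Measurable fun x => ∫ y, y ∂(Kernel.sectR κ.condKernel t) x := measurable_kernel_mean
    have hm' : Measurable fun z : State d × State d => ∫ y, y ∂(Kernel.sectR κ.condKernel t) z.1 :=
      hm.comp measurable_fst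
    rw [hdis t, lintegral_map _ (hFt t), lintegral_map _ (hFt t), lintegral_map _ (hFt t)] at key
    · simpa only [Kernel.sectR_apply] using key
    · exact ((hm'.const_smul a).sub (measurable_snd.const_smul a)).enorm.pow_const 2
    · exact ((hf.comp measurable_fst).sub (hm'.const_smul a)).enorm.pow_const 2
    · exact ((hf.comp measurable_fst).sub (measurable_snd.const_smul a)).enorm.pow_const 2
  · obtain ⟨C, hC⟩ := hC
    have key := integral_compProd_apply_mean_sub (hfin t) hG hC
    have hm : Measurable fun x => ∫ y, y ∂(Kernel.sectR κ.condKernel t) x := measurable_kernel_mean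
    have hr : Measurable fun z : State d × State d =>
        (∫ y, y ∂(Kernel.sectR κ.condKernel t) z.1) - z.2 :=
      (hm.comp measurable_fst).sub measurable_snd
    rw [hdis t, integral_map (hFt t).aemeasurable] at key
    · simpa only [Kernel.sectR_apply] using key
    · exact isBoundedBilinearMap_apply.continuous.comp_aestronglyMeasurable
        ((hG.measurable.comp measurable_fst).aestronglyMeasurable.prodMk hr.aestronglyMeasurable)

/-! ### Minimizers of the training loss -/

section Loss

variable {d : ℕ}

lemma IsMeasurableField.comp {v : VelocityField d} (hv : IsMeasurableField v) {X : Type*}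
    [MeasurableSpace X] {f : X → State d} {g h : X → ℝ} (hf : Measurable f) (hg : Measurable g)
    (hh : Measurable h) : Measurable fun x => v (f x) (g x) (h x) :=
  Measurable.comp (g := fun z : State d × ℝ × ℝ => v z.1 z.2.1 z.2.2) hv
    (hf.prodMk (hg.prodMk hh))

lemma measurable_pairInterpolant_right (t : ℝ) : Measurable (pairInterpolant (d := d) t) :=
  measurable_pairInterpolant.comp measurable_prodMk_left

lemma measurable_smul_displacement (a : ℝ) :
    Measurable fun p : State d × State d => a • (p.2 - p.1) := by
  fun_prop

lemma IsMeasurableField.measurable_trajLoss {v : VelocityField d} (hv : IsMeasurableField v)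
    (t a : ℝ) : Measurable fun p : State d × State d => trajLoss v t a p.1 p.2 := by
  have h : Measurable fun p => v (pairInterpolant t p) (t / a) a :=
    hv.comp (measurable_pairInterpolant_right t) measurable_const measurable_const
  exact (h.sub (measurable_smul_displacement a)).enorm.pow_const 2

lemma IsMeasurableField.measurable_consLoss {v : VelocityField d} (hv : IsMeasurableField v)
    (t a : ℝ) : Measurable fun p : State d × State d => consLoss v t a p.1 p.2 := by
  have h : ∀ τ b, Measurable fun p => v (pairInterpolant t p) τ b := fun τ b =>
    hv.comp (measurable_pairInterpolant_right t) measurable_const measurable_const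
  have h1 : Measurable fun p => a • v (pairInterpolant t p) t 1 := (h t 1).const_smul a
  exact ((h (t / a) a).sub h1).enorm.pow_const 2

lemma IsMeasurableField.measurable_sampleLoss {v : VelocityField d} (hv : IsMeasurableField v)
    (D : ℕ) (lam : ℝ≥0) (t α : ℝ) :
    Measurable fun p : State d × State d => sampleLoss D lam v t α p.1 p.2 := by
  unfold sampleLoss
  exact (Finset.measurable_fun_sum _ fun i _ => hv.measurable_trajLoss t (α ^ i)).add
    ((Finset.measurable_fun_sum _ fun i _ => hv.measurable_consLoss t (α ^ i)).const_mul _)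

lemma totalLoss_eq_lintegral_map {Ω : Type*} [MeasurableSpace Ω] {P : Measure Ω}
    {x₀ x₁ : Ω → State d} (hx₀ : AEMeasurable x₀ P) (hx₁ : AEMeasurable x₁ P) (D : ℕ) (lam : ℝ≥0)
    {v : VelocityField d} (hv : IsMeasurableField v) :
    totalLoss P x₀ x₁ D lam v = ∫⁻ t in Icc (0 : ℝ) 1, ∫⁻ α,
      ∫⁻ p, sampleLoss D lam v t α p.1 p.2 ∂(P.map fun ω => (x₀ ω, x₁ ω))
        ∂(ProbabilityTheory.cond volume (Icc t 1)) := by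
  unfold totalLoss
  refine lintegral_congr fun t => lintegral_congr fun α => ?_
  rw [lintegral_map' (hv.measurable_sampleLoss D lam t α).aemeasurable (hx₀.prodMk hx₁)]

/-- The field `a u(x, a τ)` generated at every scale by a single velocity `u`. -/
def scaledField (u : ℝ → State d → State d) : VelocityField d := fun x τ a => a • u (a * τ) x

lemma isMeasurableField_scaledField {u : ℝ → State d → State d}
    (hu : Measurable fun z : ℝ × State d => u z.1 z.2) : IsMeasurableField (scaledField u) := by
  have h : Measurable fun z : State d × ℝ × ℝ => u (z.2.2 * z.2.1) z.1 :=
    hu.comp (g := fun z : ℝ × State d => u z.1 z.2)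
      (f := fun z : State d × ℝ × ℝ => (z.2.2 * z.2.1, z.1)) (by fun_prop)
  exact (measurable_snd.comp measurable_snd).smul h

/-- The product `a * (t / a)` recovers the primary time; at `a = 0`, where it does not, the
prefactor `a` kills both sides. -/
lemma scaledField_div (u : ℝ → State d → State d) (x : State d) (t a : ℝ) :
    scaledField u x (t / a) a = a • u t x := by
  rcases eq_or_ne a 0 with rfl | ha
  · simp [scaledField]
  · rw [scaledField, mul_div_cancel₀ _ ha]

/-- At scale 1 the field is `u` itself, so it is exactly consistent across scales and only
trajectory supervision survives. -/
lemma sampleLoss_scaledField (D : ℕ) (lam : ℝ≥0) (u : ℝ → State d → State d) (t α : ℝ)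
    (p : State d × State d) :
    sampleLoss D lam (scaledField u) t α p.1 p.2 = ∑ i ∈ Finset.range D,
      ‖α ^ i • u t (pairInterpolant t p) - α ^ i • (p.2 - p.1)‖ₑ ^ 2 := by
  have h1 : ∀ x, scaledField u x t 1 = u t x := fun x => by simp [scaledField]
  simp only [sampleLoss, trajLoss, consLoss, scaledField_div, h1, sub_self, enorm_zero]
  simp [pairInterpolant]

/-- A nonnegative function whose average over random times and scales vanishes is almost surely
zero. -/
lemma ae_eq_zero_of_lintegral_cond {f : ℝ → ℝ → ℝ≥0∞} (hf : Measurable fun z : ℝ × ℝ => f z.1 z.2)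
    (hzero : ∫⁻ t in Icc (0 : ℝ) 1, ∫⁻ α, f t α
      ∂(ProbabilityTheory.cond volume (Icc t 1)) = 0) :
    ∀ᵐ t ∂(volume.restrict (Icc (0 : ℝ) 1)), ∀ᵐ α ∂(volume.restrict (Icc t 1)), f t α = 0 := by
  have hcond : ∀ t, ∫⁻ α, f t α ∂(ProbabilityTheory.cond volume (Icc t 1)) =
      (volume (Icc t 1))⁻¹ * ∫⁻ α in Icc t 1, f t α := fun t => by
    rw [ProbabilityTheory.cond, lintegral_smul_measure, smul_eq_mul]
  simp_rw [hcond] at hzero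
  have hIm : Measurable fun t => ∫⁻ α in Icc t 1, f t α := by
    have : ∀ t, ∫⁻ α in Icc t 1, f t α = ∫⁻ α,
        indicator {z : ℝ × ℝ | z.1 ≤ z.2 ∧ z.2 ≤ 1} (fun z => f z.1 z.2) (t, α) := fun t => by
      rw [← lintegral_indicator measurableSet_Icc]
      refine lintegral_congr fun α => ?_
      simp only [indicator, mem_Icc, mem_ofPred_eq]
    simp_rw [this]
    refine Measurable.lintegral_prod_right' (hf.indicator ?_)
    exact (measurableSet_le measurable_fst measurable_snd).inter
      (measurableSet_le measurable_snd measurable_const)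
  have hvol : Measurable fun t : ℝ => volume (Icc t 1) := by
    simp_rw [Real.volume_Icc]; fun_prop
  have hprod : Measurable fun t => (volume (Icc t 1))⁻¹ * ∫⁻ α in Icc t 1, f t α :=
    hvol.inv.mul hIm
  rw [lintegral_eq_zero_iff hprod] at hzero
  filter_upwards [hzero] with t ht
  -- The normalizing factor vanishes only for an interval of infinite length; its value `∞` at `t =
  -- 1` does no harm.
  have ht' : ∫⁻ α in Icc t 1, f t α = 0 := by
    rcases mul_eq_zero.1 ht with h | h
    · rw [ENNReal.inv_eq_zero, Real.volume_Icc] at h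
      exact absurd h ENNReal.ofReal_ne_top
    · exact h
  have hslice : Measurable fun α => f t α := hf.comp measurable_prodMk_left
  rw [lintegral_eq_zero_iff hslice] at ht'
  exact ht'

/-- Averaging over the conditional scale does not increase upper bounds. -/
lemma lintegral_cond_Icc_le {t : ℝ} {f : ℝ → ℝ≥0∞} {c : ℝ≥0∞} (hf : ∀ α ∈ Icc t 1, f α ≤ c) :
    ∫⁻ α, f α ∂(ProbabilityTheory.cond volume (Icc t 1)) ≤ c := by
  rw [ProbabilityTheory.cond, lintegral_smul_measure, smul_eq_mul]
  calc (volume (Icc t 1))⁻¹ * ∫⁻ α in Icc t 1, f α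
      ≤ (volume (Icc t 1))⁻¹ * ∫⁻ α in Icc t 1, c :=
        mul_le_mul_right (setLIntegral_mono measurable_const hf) _
    _ = c * ((volume (Icc t 1))⁻¹ * volume (Icc t 1)) := by
        rw [setLIntegral_const]; ring
    -- Only an inequality: for `t ≥ 1` the interval is null and the conditional measure is zero.
    _ ≤ c * 1 := mul_le_mul_right (ENNReal.inv_mul_le_one _) _
    _ = c := mul_one _

/-- A measurable field whose loss is at most that of the scaled conditional velocity agrees with it
at the secondary scale. -/
lemma ae_eq_conditional_velocity {π : Measure (State d × State d)} [IsProbabilityMeasure π]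
    (hπ : MemLp (fun p => p.2 - p.1) 2 π) {D : ℕ} (hD : 2 ≤ D) (lam : ℝ≥0)
    {u : ℝ → State d → State d} (hu : Measurable fun z : ℝ × State d => u z.1 z.2)
    (hbv : ∀ t (f : State d → State d), Measurable f → ∀ a : ℝ,
        ∫⁻ p, ‖f (pairInterpolant t p) - a • (p.2 - p.1)‖ₑ ^ 2 ∂π =
          ∫⁻ p, ‖f (pairInterpolant t p) - a • u t (pairInterpolant t p)‖ₑ ^ 2 ∂π +
          ∫⁻ p, ‖a • u t (pairInterpolant t p) - a • (p.2 - p.1)‖ₑ ^ 2 ∂π)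
    {v : VelocityField d} (hv : IsMeasurableField v)
    (hle : ∫⁻ t in Icc (0 : ℝ) 1, ∫⁻ α, ∫⁻ p, sampleLoss D lam v t α p.1 p.2 ∂π
        ∂(ProbabilityTheory.cond volume (Icc t 1)) ≤
      ∫⁻ t in Icc (0 : ℝ) 1, ∫⁻ α, ∫⁻ p, sampleLoss D lam (scaledField u) t α p.1 p.2 ∂π
        ∂(ProbabilityTheory.cond volume (Icc t 1))) :
    ∀ᵐ t ∂(volume.restrict (Icc (0 : ℝ) 1)), ∀ᵐ α ∂(volume.restrict (Icc t 1)), ∀ᵐ p ∂π,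
      v (pairInterpolant t p) (t / α) α = α • u t (pairInterpolant t p) := by
  set excess : ℝ → ℝ → ℝ≥0∞ := fun t α =>
    ∫⁻ p, ‖v (pairInterpolant t p) (t / α) α - α • u t (pairInterpolant t p)‖ₑ ^ 2 ∂π with hex
  set R : ℝ → ℝ → ℝ≥0∞ := fun t a =>
    ∫⁻ p, ‖a • u t (pairInterpolant t p) - a • (p.2 - p.1)‖ₑ ^ 2 ∂π with hR
  have hum : ∀ t : ℝ, Measurable fun p => u t (pairInterpolant (d := d) t p) := fun t =>
    hu.comp (g := fun z : ℝ × State d => u z.1 z.2) (measurable_const.prodMk (measurable_pairInterpolant_right t))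
  have hSw : ∀ t α, ∫⁻ p, sampleLoss D lam (scaledField u) t α p.1 p.2 ∂π =
      ∑ i ∈ Finset.range D, R t (α ^ i) := fun t α => by
    simp_rw [sampleLoss_scaledField]
    rw [lintegral_finsetSum _ fun i _ => ?_]
    have h1 : Measurable fun p => α ^ i • u t (pairInterpolant t p) := (hum t).const_smul (α ^ i)
    exact (h1.sub (measurable_smul_displacement (α ^ i))).enorm.pow_const 2
  have hSv : ∀ t α, (∑ i ∈ Finset.range D, R t (α ^ i)) + excess t α ≤
      ∫⁻ p, sampleLoss D lam v t α p.1 p.2 ∂π := fun t α => by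
    have htraj : ∀ a, ∫⁻ p, trajLoss v t a p.1 p.2 ∂π = excess t a + R t a := fun a =>
      hbv t (fun x => v x (t / a) a) (hv.comp measurable_id measurable_const measurable_const) a
    calc (∑ i ∈ Finset.range D, R t (α ^ i)) + excess t α
        ≤ (∑ i ∈ Finset.range D, R t (α ^ i)) + ∑ i ∈ Finset.range D, excess t (α ^ i) := by
          refine add_le_add le_rfl ?_
          -- Depth at least 2 enters here: the index `i = 1` is the scale `α` itself.
          have := Finset.single_le_sum (f := fun i => excess t (α ^ i)) (fun _ _ => zero_le)
            (Finset.mem_range.2 (by omega : 1 < D))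
          simpa using this
      _ = ∑ i ∈ Finset.range D, ∫⁻ p, trajLoss v t (α ^ i) p.1 p.2 ∂π := by
          rw [add_comm, ← Finset.sum_add_distrib]
          exact Finset.sum_congr rfl fun i _ => (htraj _).symm
      _ = ∫⁻ p, ∑ i ∈ Finset.range D, trajLoss v t (α ^ i) p.1 p.2 ∂π := by
          rw [lintegral_finsetSum _ fun i _ => hv.measurable_trajLoss t (α ^ i)]
      _ ≤ _ := lintegral_mono fun p => le_self_add
  -- the optimal loss is finite
  set m : ℝ≥0∞ := ∫⁻ p, ‖p.2 - p.1‖ₑ ^ 2 ∂π with hm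
  have hmfin : m < ∞ := (memLp_two_iff_lintegral_enorm_sq hπ.1).1 hπ
  have hRle : ∀ t, ∀ a ∈ Icc (0 : ℝ) 1, R t a ≤ m := fun t a ha => by
    -- Comparison with the zero predictor bounds the irreducible error.
    have h := hbv t 0 measurable_const a
    simp only [Pi.zero_apply, zero_sub, enorm_neg] at h
    calc R t a ≤ ∫⁻ p, ‖a • (p.2 - p.1)‖ₑ ^ 2 ∂π := by rw [h]; exact le_add_self
      _ ≤ m := lintegral_mono fun p => by
        have : ‖a • (p.2 - p.1)‖ₑ ≤ ‖p.2 - p.1‖ₑ := by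
          rw [enorm_le_iff_norm_le, norm_smul, Real.norm_eq_abs, abs_of_nonneg ha.1]
          exact mul_le_of_le_one_left (norm_nonneg _) ha.2
        gcongr
  have hfin : ∫⁻ t in Icc (0 : ℝ) 1, ∫⁻ α, ∑ i ∈ Finset.range D, R t (α ^ i)
      ∂(ProbabilityTheory.cond volume (Icc t 1)) < ∞ := by
    have hb : ∀ t ∈ Icc (0 : ℝ) 1, ∫⁻ α, ∑ i ∈ Finset.range D, R t (α ^ i)
        ∂(ProbabilityTheory.cond volume (Icc t 1)) ≤ D * m := fun t ht => by
      refine lintegral_cond_Icc_le fun α hα => ?_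
      refine (Finset.sum_le_card_nsmul _ _ m fun i _ => hRle t _ ?_).trans_eq (by simp)
      exact ⟨pow_nonneg (ht.1.trans hα.1) _, pow_le_one₀ (ht.1.trans hα.1) hα.2⟩
    refine (setLIntegral_mono measurable_const hb).trans_lt ?_
    rw [setLIntegral_const, Real.volume_Icc]
    exact ENNReal.mul_lt_top (ENNReal.mul_lt_top (ENNReal.natCast_lt_top D) hmfin)
      ENNReal.ofReal_lt_top
  -- hence the excess vanishes
  have hzero : ∫⁻ t in Icc (0 : ℝ) 1, ∫⁻ α, excess t α
      ∂(ProbabilityTheory.cond volume (Icc t 1)) = 0 := by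
    simp_rw [hSw] at hle
    -- Superadditivity of the lower integral suffices, so no measurability is needed to split the
    -- sum.
    have h1 := calc
      (∫⁻ t in Icc (0 : ℝ) 1, ∫⁻ α, ∑ i ∈ Finset.range D, R t (α ^ i)
          ∂(ProbabilityTheory.cond volume (Icc t 1))) +
        ∫⁻ t in Icc (0 : ℝ) 1, ∫⁻ α, excess t α ∂(ProbabilityTheory.cond volume (Icc t 1))
        ≤ ∫⁻ t in Icc (0 : ℝ) 1, ((∫⁻ α, ∑ i ∈ Finset.range D, R t (α ^ i)
          ∂(ProbabilityTheory.cond volume (Icc t 1))) +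
            ∫⁻ α, excess t α ∂(ProbabilityTheory.cond volume (Icc t 1))) := le_lintegral_add _ _
      _ ≤ ∫⁻ t in Icc (0 : ℝ) 1, ∫⁻ α, ((∑ i ∈ Finset.range D, R t (α ^ i)) + excess t α)
          ∂(ProbabilityTheory.cond volume (Icc t 1)) := lintegral_mono fun t => le_lintegral_add _ _
      _ ≤ ∫⁻ t in Icc (0 : ℝ) 1, ∫⁻ α, ∫⁻ p, sampleLoss D lam v t α p.1 p.2 ∂π
          ∂(ProbabilityTheory.cond volume (Icc t 1)) :=
        lintegral_mono fun t => lintegral_mono fun α => hSv t α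
      _ ≤ _ := hle
    by_contra hne
    exact absurd h1 (not_le.2 (ENNReal.lt_add_right hfin.ne hne))
  have hexm : Measurable fun z : ℝ × ℝ => excess z.1 z.2 := by
    have hx : Measurable fun z : (ℝ × ℝ) × State d × State d => pairInterpolant z.1.1 z.2 :=
      measurable_pairInterpolant.comp
        (f := fun z : (ℝ × ℝ) × State d × State d => (z.1.1, z.2)) (by fun_prop)
    refine Measurable.lintegral_prod_right' (f := fun z : (ℝ × ℝ) × State d × State d =>
      ‖v (pairInterpolant z.1.1 z.2) (z.1.1 / z.1.2) z.1.2 -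
        z.1.2 • u z.1.1 (pairInterpolant z.1.1 z.2)‖ₑ ^ 2) ?_
    have m1 : Measurable fun z : (ℝ × ℝ) × State d × State d =>
        u z.1.1 (pairInterpolant z.1.1 z.2) :=
      hu.comp (g := fun z : ℝ × State d => u z.1 z.2)
        ((measurable_fst.comp measurable_fst).prodMk hx)
    have m2 : Measurable fun z : (ℝ × ℝ) × State d × State d =>
        z.1.2 • u z.1.1 (pairInterpolant z.1.1 z.2) := (measurable_snd.comp measurable_fst).smul m1
    have m3 : Measurable fun z : (ℝ × ℝ) × State d × State d =>
        v (pairInterpolant z.1.1 z.2) (z.1.1 / z.1.2) z.1.2 :=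
      hv.comp hx (by fun_prop) (by fun_prop)
    exact (m3.sub m2).enorm.pow_const 2
  filter_upwards [ae_eq_zero_of_lintegral_cond hexm hzero] with t ht
  filter_upwards [ht] with α hα
  have hmeas : Measurable fun p : State d × State d =>
      ‖v (pairInterpolant t p) (t / α) α - α • u t (pairInterpolant t p)‖ₑ ^ 2 := by
    have m1 : Measurable fun p => v (pairInterpolant t p) (t / α) α :=
      hv.comp (measurable_pairInterpolant_right t) measurable_const measurable_const
    have m2 : Measurable fun p => α • u t (pairInterpolant t p) := (hum t).const_smul α
    exact (m1.sub m2).enorm.pow_const 2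
  have hα' := (lintegral_eq_zero_iff hmeas).1 hα
  filter_upwards [hα'] with p hp
  simpa [sub_eq_zero] using hp

end Loss

/-! ### From almost all to all times and scales -/

section Drift

variable {d : ℕ}

/-- Continuous dependence of the regression residual on time and scale. -/
lemma continuousOn_integral_residual {π : Measure (State d × State d)} [IsProbabilityMeasure π]
    (h₀ : MemLp (Prod.fst : State d × State d → State d) 2 π)
    (h₁ : MemLp (Prod.snd : State d × State d → State d) 2 π) {v : VelocityField d} {K : ℝ≥0}
    (hcont : ContinuousOn (fun z : State d × ℝ × ℝ => v z.1 z.2.1 z.2.2)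
      (univ ×ˢ Icc 0 1 ×ˢ Ioc 0 1))
    (hlip : ∀ t ∈ Icc (0 : ℝ) 1, ∀ a ∈ Ioc (0 : ℝ) 1, LipschitzWith K fun x => v x t a)
    {G : State d → State d →L[ℝ] ℂ} (hG : Continuous G) {C : ℝ} (hC : ∀ x, ‖G x‖ ≤ C)
    {S : Set ℝ} (hS : IsCompact S) {t τ a : ℝ → ℝ} (ht : ContinuousOn t S)
    (hτ : ContinuousOn τ S) (ha : ContinuousOn a S) (ht1 : MapsTo t S (Icc 0 1))
    (hτ1 : MapsTo τ S (Icc 0 1)) (ha1 : MapsTo a S (Ioc 0 1)) :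
    ContinuousOn (fun r => ∫ p, G (pairInterpolant (t r) p)
      (v (pairInterpolant (t r) p) (τ r) (a r) - a r • (p.2 - p.1)) ∂π) S := by
  obtain ⟨C₀, hC₀⟩ : ∃ C₀, ∀ r ∈ S, ‖v 0 (τ r) (a r)‖ ≤ C₀ := by
    refine hS.exists_bound_of_continuousOn (f := fun r => v 0 (τ r) (a r)) ?_
    exact hcont.comp (f := fun r => ((0 : State d), τ r, a r))
      (continuousOn_const.prodMk (hτ.prodMk ha)) fun r hr => ⟨trivial, hτ1 hr, ha1 hr⟩
  have hxc : ∀ r, Continuous (pairInterpolant (d := d) (t r)) := fun r => by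
    unfold pairInterpolant; fun_prop
  have hC0 : 0 ≤ C := (norm_nonneg _).trans (hC 0)
  -- Dominated convergence: compactness of `S` bounds `v` at the origin and the Lipschitz condition
  -- gives linear growth in the pair.
  refine continuousOn_of_dominated
    (bound := fun p => C * (C₀ + K * (‖p.1‖ + ‖p.2‖) + (‖p.1‖ + ‖p.2‖))) (fun r hr => ?_)
    (fun r hr => Filter.Eventually.of_forall fun p => ?_) ?_
    (Filter.Eventually.of_forall fun p => ?_)
  · have hv : Continuous fun x => v x (τ r) (a r) := (hlip _ (hτ1 hr) _ (ha1 hr)).continuous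
    have : Continuous fun p : State d × State d => G (pairInterpolant (t r) p)
        (v (pairInterpolant (t r) p) (τ r) (a r) - a r • (p.2 - p.1)) :=
      (hG.comp (hxc r)).clm_apply ((hv.comp (hxc r)).sub (by fun_prop))
    exact this.aestronglyMeasurable
  · refine (ContinuousLinearMap.le_opNorm _ _).trans ?_
    refine mul_le_mul (hC _) ?_ (norm_nonneg _) hC0
    set x := pairInterpolant (t r) p with hx
    have hxn : ‖x‖ ≤ ‖p.1‖ + ‖p.2‖ := by
      have h0 := (ht1 hr).1
      have h1 := (ht1 hr).2
      refine (norm_add_le _ _).trans (add_le_add ?_ ?_)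
      · rw [norm_smul, Real.norm_eq_abs, abs_of_nonneg (by linarith)]
        exact mul_le_of_le_one_left (norm_nonneg _) (by linarith)
      · rw [norm_smul, Real.norm_eq_abs, abs_of_nonneg h0]
        exact mul_le_of_le_one_left (norm_nonneg _) h1
    have hvn : ‖v x (τ r) (a r)‖ ≤ C₀ + K * (‖p.1‖ + ‖p.2‖) := by
      have e1 : ‖v x (τ r) (a r) - v 0 (τ r) (a r)‖ ≤ K * ‖x‖ := by
        simpa using (hlip _ (hτ1 hr) _ (ha1 hr)).norm_sub_le x 0
      have e2 := norm_add_le (v x (τ r) (a r) - v 0 (τ r) (a r)) (v 0 (τ r) (a r))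
      rw [sub_add_cancel] at e2
      have e3 := mul_le_mul_of_nonneg_left hxn K.coe_nonneg
      linarith [hC₀ r hr]
    refine (norm_sub_le _ _).trans (add_le_add hvn ?_)
    rw [norm_smul, Real.norm_eq_abs, abs_of_nonneg (ha1 hr).1.le]
    refine (mul_le_of_le_one_left (norm_nonneg _) (ha1 hr).2).trans ?_
    exact (norm_sub_le _ _).trans (add_comm _ _).le
  · have i1 : Integrable (fun p : State d × State d => ‖p.1‖ + ‖p.2‖) π :=
      (h₀.integrable one_le_two).norm.add (h₁.integrable one_le_two).norm
    exact (((integrable_const C₀).add (i1.const_mul (K : ℝ))).add i1).const_mul C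
  · have hx : ContinuousOn (fun r => pairInterpolant (t r) p) S := by
      unfold pairInterpolant
      exact ((continuousOn_const.sub ht).smul continuousOn_const).add (ht.smul continuousOn_const)
    have hv : ContinuousOn (fun r => v (pairInterpolant (t r) p) (τ r) (a r)) S :=
      hcont.comp (f := fun r => (pairInterpolant (t r) p, τ r, a r))
        (hx.prodMk (hτ.prodMk ha)) fun r hr => ⟨trivial, hτ1 hr, ha1 hr⟩
    exact (hG.comp_continuousOn hx).clm_apply (hv.sub (ha.smul continuousOn_const))

/-- A continuous field which agrees with the scaled conditional velocity at almost all scales and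
times has the displacement as conditional mean, at all scales and times. -/
lemma integral_residual_eq_zero {π : Measure (State d × State d)} [IsProbabilityMeasure π]
    (h₀ : MemLp (Prod.fst : State d × State d → State d) 2 π)
    (h₁ : MemLp (Prod.snd : State d × State d → State d) 2 π) {v : VelocityField d} {K : ℝ≥0}
    (hcont : ContinuousOn (fun z : State d × ℝ × ℝ => v z.1 z.2.1 z.2.2)
      (univ ×ˢ Icc 0 1 ×ˢ Ioc 0 1))
    (hlip : ∀ t ∈ Icc (0 : ℝ) 1, ∀ a ∈ Ioc (0 : ℝ) 1, LipschitzWith K fun x => v x t a)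
    {u : ℝ → State d → State d}
    (horth : ∀ t (G : State d → State d →L[ℝ] ℂ), Continuous G → (∃ C, ∀ x, ‖G x‖ ≤ C) →
        ∫ p, G (pairInterpolant t p) (u t (pairInterpolant t p) - (p.2 - p.1)) ∂π = 0)
    (hae : ∀ᵐ t ∂(volume.restrict (Icc (0 : ℝ) 1)), ∀ᵐ α ∂(volume.restrict (Icc t 1)),
      ∀ᵐ p ∂π, v (pairInterpolant t p) (t / α) α = α • u t (pairInterpolant t p))
    {G : State d → State d →L[ℝ] ℂ} (hG : Continuous G) {C : ℝ} (hC : ∀ x, ‖G x‖ ≤ C)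
    {α : ℝ} (hα : α ∈ Ioc (0 : ℝ) 1) {t : ℝ} (ht : t ∈ Icc 0 α) :
    ∫ p, G (pairInterpolant t p)
      (v (pairInterpolant t p) (t / α) α - α • (p.2 - p.1)) ∂π = 0 := by
  set F : ℝ → ℝ → ℂ := fun t α => ∫ p, G (pairInterpolant t p)
    (v (pairInterpolant t p) (t / α) α - α • (p.2 - p.1)) ∂π with hF
  have hFae : ∀ᵐ t ∂(volume.restrict (Icc (0 : ℝ) 1)), ∀ᵐ α ∂(volume.restrict (Icc t 1)),
      F t α = 0 := by
    filter_upwards [hae] with t ht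
    filter_upwards [ht] with α hα
    have : F t α = ∫ p, α • G (pairInterpolant t p)
        (u t (pairInterpolant t p) - (p.2 - p.1)) ∂π := by
      refine integral_congr_ae ?_
      filter_upwards [hα] with p hp
      rw [hp, ← smul_sub, map_smul]
    rw [this, integral_smul, horth t G hG ⟨C, hC⟩, smul_zero]
  -- Two one-dimensional extensions: first in the scale over `[t, 1]` for almost every `t`, then in
  -- time over `[0, α]` for the given `α`.
  have hFt : ∀ᵐ t ∂(volume.restrict (Icc (0 : ℝ) 1)), ∀ α ∈ Icc t 1, F t α = 0 := by
    -- `t ≠ 0` keeps the scales in `[t, 1]` positive, and `t ≠ 1` makes that interval nondegenerate.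
    have hne0 : ∀ᵐ t ∂(volume.restrict (Icc (0 : ℝ) 1)), t ≠ 0 := Measure.ae_ne _ 0
    have hne1 : ∀ᵐ t ∂(volume.restrict (Icc (0 : ℝ) 1)), t ≠ 1 := Measure.ae_ne _ 1
    filter_upwards [hFae, hne0, hne1, ae_restrict_mem measurableSet_Icc] with t h1 h2 h3 h4
    have hpos : 0 < t := lt_of_le_of_ne h4.1 h2.symm
    have hc : ContinuousOn (F t) (Icc t 1) :=
      continuousOn_integral_residual h₀ h₁ hcont hlip hG hC isCompact_Icc (t := fun _ => t)
        (τ := fun α => t / α) (a := fun α => α) continuousOn_const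
        (continuousOn_const.div continuousOn_id fun r hr => (hpos.trans_le hr.1).ne')
        continuousOn_id (fun _ _ => h4)
        (fun r hr => ⟨div_nonneg h4.1 (hpos.le.trans hr.1),
          div_le_one_of_le₀ hr.1 (hpos.le.trans hr.1)⟩)
        (fun r hr => ⟨hpos.trans_le hr.1, hr.2⟩)
    exact Measure.eqOn_Icc_of_ae_eq volume h3 h1 hc continuousOn_const
  have hc : ContinuousOn (fun t => F t α) (Icc 0 α) :=
    continuousOn_integral_residual h₀ h₁ hcont hlip hG hC isCompact_Icc (t := fun t => t)
      (τ := fun t => t / α) (a := fun _ => α) continuousOn_id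
      (continuousOn_id.div_const α) continuousOn_const
      (fun r hr => ⟨hr.1, hr.2.trans hα.2⟩)
      (fun r hr => ⟨div_nonneg hr.1 hα.1.le, div_le_one_of_le₀ hr.2 hα.1.le⟩) (fun _ _ => hα)
  have hα0 : ∀ᵐ t ∂(volume.restrict (Icc 0 α)), F t α = 0 := by
    have hsub : Icc 0 α ⊆ Icc 0 1 := Icc_subset_Icc_right hα.2
    have h := ae_restrict_of_ae_restrict_of_subset hsub hFt
    filter_upwards [h, ae_restrict_mem measurableSet_Icc] with t h1 h2
    exact h1 α ⟨h2.2, hα.2⟩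
  exact Measure.eqOn_Icc_of_ae_eq volume hα.1.ne hα0 hc continuousOn_const ht

end Drift

end RecFM

/-! ### Marginal preservation -/

theorem mainTheorem2 {d : ℕ}
    -- a probability space carrying the pair (x₀, x₁)
    {Ω : Type*} [MeasurableSpace Ω] (P : Measure Ω) [IsProbabilityMeasure P]
    (x₀ x₁ : Ω → RecFM.State d) (p₀ p₁ : Measure (RecFM.State d))
    (hx₀ : HasLaw x₀ p₀ P) (hx₁ : HasLaw x₁ p₁ P)
    (hp₀ : MemLp id 2 p₀) (hp₁ : MemLp id 2 p₁)
    -- the training objective: depth and consistency weight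
    (D : ℕ) (hD : 2 ≤ D) (lam : ℝ≥0)
    -- the optimal velocity: a global minimizer over a sufficiently expressive class
    {Θ : Type*} (v : Θ → RecFM.VelocityField d)
    (hexp : RecFM.SufficientlyExpressive P x₀ x₁ D lam v)
    (θ : Θ) (hmin : RecFM.IsGlobalMinimizer P x₀ x₁ D lam v θ)
    -- the optimal velocity is continuous, and Lipschitz in x uniformly in time and scale
    (hcont : ContinuousOn (fun z : RecFM.State d × ℝ × ℝ => v θ z.1 z.2.1 z.2.2)
      (univ ×ˢ Icc 0 1 ×ˢ Ioc 0 1))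
    (hlip : ∃ K : ℝ≥0, ∀ t ∈ Icc (0 : ℝ) 1, ∀ a ∈ Ioc (0 : ℝ) 1,
      LipschitzWith K fun x => v θ x t a)
    (α : ℝ) (hα : α ∈ Ioc (0 : ℝ) 1) :
    -- the ODE is uniquely solvable on [0, 1] from every initial point
    (∀ x : RecFM.State d, ∃ y : ℝ → RecFM.State d,
      (y 0 = x ∧ RecFM.IsTrajectory (v θ) α y) ∧
        ∀ z : ℝ → RecFM.State d, z 0 = x → RecFM.IsTrajectory (v θ) α z →
          EqOn z y (Icc 0 1)) ∧
    -- the law of any solution started from p₀ is the law of the interpolant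
    ∀ {Ω' : Type*} [MeasurableSpace Ω'] (P' : Measure Ω') (X : ℝ → Ω' → RecFM.State d),
      RecFM.IsRandomTrajectory (v θ) α p₀ P' X →
        (∀ τ ∈ Icc (0 : ℝ) 1, HasLaw (X τ) (RecFM.marginal P x₀ x₁ (α * τ)) P') ∧
        P'.map (X 0) = p₀ ∧ P'.map (X 1) = RecFM.marginal P x₀ x₁ α := by
  obtain ⟨K, hK⟩ := hlip
  have hKα : ∀ s ∈ Icc (0 : ℝ) 1, LipschitzWith K fun x => v θ x s α := fun s hs => hK s hs α hα
  have hcontα : ContinuousOn (fun z : ℝ × RecFM.State d => v θ z.2 z.1 α) (Icc 0 1 ×ˢ univ) :=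
    hcont.comp (f := fun z : ℝ × RecFM.State d => (z.2, z.1, α)) (by fun_prop)
      fun z hz => ⟨trivial, hz.1, hα⟩
  refine ⟨fun x => ?_, fun P' X hX => ?_⟩
  · obtain ⟨y, hy0, hy⟩ := RecFM.exists_solution_of_lipschitz (f := fun s x => v θ x s α) hKα
      (fun x => hcontα.comp (f := fun s : ℝ => (s, x)) (by fun_prop) fun s hs => ⟨hs, trivial⟩) x
    exact ⟨y, ⟨hy0, hy⟩, fun z hz0 hz =>
      RecFM.eqOn_solution_of_lipschitz (f := fun s x => v θ x s α) hKα hy hz (hz0.trans hy0.symm)⟩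
  · have hpair : AEMeasurable (fun ω => (x₀ ω, x₁ ω)) P := hx₀.aemeasurable.prodMk hx₁.aemeasurable
    set π := P.map fun ω => (x₀ ω, x₁ ω) with hπdef
    have hπ : IsProbabilityMeasure π := Measure.isProbabilityMeasure_map hpair
    have h₀ : MemLp (Prod.fst : RecFM.State d × RecFM.State d → RecFM.State d) 2 π := by
      rw [hπdef, memLp_map_measure_iff measurable_fst.aestronglyMeasurable hpair]
      rw [← hx₀.map_eq, memLp_map_measure_iff aestronglyMeasurable_id hx₀.aemeasurable] at hp₀
      exact hp₀
    have h₁ : MemLp (Prod.snd : RecFM.State d × RecFM.State d → RecFM.State d) 2 π := by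
      rw [hπdef, memLp_map_measure_iff measurable_snd.aestronglyMeasurable hpair]
      rw [← hx₁.map_eq, memLp_map_measure_iff aestronglyMeasurable_id hx₁.aemeasurable] at hp₁
      exact hp₁
    obtain ⟨u, hu, hbv, horth⟩ := RecFM.exists_conditional_velocity π (h₁.sub h₀)
    have hwm := RecFM.isMeasurableField_scaledField hu
    have hle : RecFM.totalLoss P x₀ x₁ D lam (v θ) ≤
        RecFM.totalLoss P x₀ x₁ D lam (RecFM.scaledField u) :=
      (le_iInf hmin).trans (hexp.2 _ hwm)
    rw [RecFM.totalLoss_eq_lintegral_map hx₀.aemeasurable hx₁.aemeasurable D lam (hexp.1 θ),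
      RecFM.totalLoss_eq_lintegral_map hx₀.aemeasurable hx₁.aemeasurable D lam hwm] at hle
    have hae := RecFM.ae_eq_conditional_velocity (h₁.sub h₀) hD lam hu hbv (hexp.1 θ) hle
    have hlaw : ∀ τ ∈ Icc (0 : ℝ) 1,
        HasLaw (X τ) (RecFM.marginal P x₀ x₁ (α * τ)) P' := fun τ hτ => by
      -- The interpolant run at speed `α` is a straight line with velocity `α • (x₁ - x₀)`, so
      -- secondary time `s` corresponds to primary time `α * s`.
      have hline : ∀ (s : ℝ) (p : RecFM.State d × RecFM.State d),
          p.1 + s • α • (p.2 - p.1) = RecFM.pairInterpolant (α * s) p := fun s p => by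
        rw [RecFM.pairInterpolant, smul_smul, mul_comm s α, smul_sub, sub_smul, one_smul]
        abel
      have key := RecFM.hasLaw_of_conditional_velocity (π := π) (Z₀ := Prod.fst)
        (W := fun p => α • (p.2 - p.1)) (b := fun s x => v θ x s α) (P' := P') (X := X) h₀
        ((h₁.sub h₀).const_smul α) hKα hcontα (fun s hs G hG hC => by
          obtain ⟨C, hC⟩ := hC
          simp only [hline]
          have := RecFM.integral_residual_eq_zero h₀ h₁ hcont hK horth hae hG hC hα
            (t := α * s) ⟨mul_nonneg hα.1.le hs.1, mul_le_of_le_one_right hα.1.le hs.2⟩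
          rwa [mul_div_cancel_left₀ _ hα.1.ne'] at this)
        (by
          have : π.map Prod.fst = p₀ := by
            rw [hπdef, AEMeasurable.map_map_of_aemeasurable measurable_fst.aemeasurable hpair]
            exact hx₀.map_eq
          rw [this]
          exact hX.initial) hX.ode hτ
      have hmarg : (π.map fun p => p.1 + τ • α • (p.2 - p.1)) =
          RecFM.marginal P x₀ x₁ (α * τ) := by
        simp only [hline]
        rw [hπdef, AEMeasurable.map_map_of_aemeasurable
          (RecFM.measurable_pairInterpolant_right (α * τ)).aemeasurable hpair]
        rfl
      rwa [hmarg] at key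
    refine ⟨hlaw, hX.initial.map_eq, ?_⟩
    have := (hlaw 1 ⟨zero_le_one, le_rfl⟩).map_eq
    rwa [mul_one] at this
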